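/- Let $n\ge 2$, let $\mathbb R^n_+$ and $\mathbb R^n_{++}$ be the sets of vectors with non-negative, respectively strictly positive, components, and let $L,N$ be linear operators on $\mathbb R^n$, $A=\mathrm{diag}(A_1,\dots,A_n)$ with $A_i>0$, $p_i>0$ for $i=1,\dots,n$, $\rho>0$ and $\gamma>0$. Assume that $e^{tL}(\mathbb R^n_+)\subseteq\mathbb R^n_+$ for all $t\ge 0$, that $N(\mathbb R^n_+)\subseteq\mathbb R^n_+$ and $Ne_i\ne 0$ for every $i$, and that there are $b^\star\in\mathbb R^n_{++}$ and $\lambda_\star>0$ with $(L+A)^Tb^\star=\lambda_\star b^\star$ and $\rho>\lambda_\star(1-\gamma)$. For $k\in\mathbb R^n_+$ and $C\in L^1_{\rm loc}([0,\infty);\mathbb R^n_+)$ let $$K^{k,C}(t)=e^{t(L+A)}k-\int_0^te^{(t-s)(L+A)}NC(s)\,ds,\qquad t\ge 0,$$ be the solution of $K'=(L+A)K-NC$, $K(0)=k$, and let $\mathcal A_+(k)$ be the set of those $C$ for which $K^{k,C}(t)\in\mathbb R^n_+$ for all $t\ge 0$. Let $u_\gamma(x)=x^{1-\gamma}/(1-\gamma)$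 if $\gamma\ne1$ and $u_1(x)=\log x$, for $x\ge0$ (with $u_\gamma(0)=-\infty$ if $\gamma\ge1$), let $U_\gamma(c)=\sum_ip_iu_\gamma(c_i)$, and $$V(k)=\sup_{C\in\mathcal A_+(k)}J(C),\qquad J(C)=\int_0^\infty e^{-\rho t}U_\gamma(C(t))\,dt .$$ For $q$ with $N^Tq\in\mathbb R^n_{++}$ let $\widehat c(q)$ be the vector with components $\widehat c_i(q)=\bigl(p_i/[N^Tq]_i\bigr)^{1/\gamma}$. Let $D^+V(x)$ denote the superdifferential of $V$ at $x$, that is, the set of all $q\in\mathbb R^n$ with $\limsup_{y\to x,\;y\in\mathbb R^n_+}\frac{V(y)-V(x)-\langle q,y-x\rangle}{\|y-x\|}\le 0$. Fix $k\in\mathbb R^n_+$ with $V(k)>-\infty$, let $\widehat C\in\mathcal A_+(k)$ be an optimal control for $k$, that is, $J(\widehat C)=V(k)$, and let $T=\{t\ge0: K^{k,\widehat C}(t)\in\mathbb R^n_{++}\}$. Then, after modification on a null set of times, $\widehat C$ is continuous on $T$ and $\widehat C(t)\in\mathbb R^n_{++}$ for every $t\in T$. Moreover, for every $t\in T$, writing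 $x=K^{k,\widehat C}(t)$: $V$ is finite in a neighbourhood of $x$; $D^+V(x)\neq\emptyset$; and every $q\in D^+V(x)$ satisfies $N^Tq\in\mathbb R^n_{++}$, $\widehat c(q)$ maximizes $c\mapsto-\langle Nc,q\rangle+U_\gamma(c)$ over $\mathbb R^n_+$, and $\widehat C(t)=\widehat c(q)$. In particular, if $V$ is differentiable at $x$, then $$\widehat C(t)=\widehat c\bigl(DV(K^{k,\widehat C}(t))\bigr).$$ If $N$ is injective, then $V$ is differentiable at $K^{k,\widehat C}(t)$ for every $t\in T$, so that this feedback formula holds at all such times. -/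

import Mathlib

open MeasureTheory Filter Topology

noncomputable section

namespace GrowthNetwork

/-- The closed positive orthant. -/
def orthant (n : ℕ) : Set (EuclideanSpace ℝ (Fin n)) := {x | ∀ i, 0 ≤ x i}

/-- The strictly positive orthant. -/
def openOrthant (n : ℕ) : Set (EuclideanSpace ℝ (Fin n)) := {x | ∀ i, 0 < x i}

/-- The data of the problem: capital mobility `L`, impact of consumption `N`, productivities `a`
(the diagonal of the matrix `A`), weights `p`, discount rate `ρ`, and utility exponent `γ`.
There are only data here; all assumptions on them are stated in the theorem. -/
structure Model (n : ℕ) where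
  L : EuclideanSpace ℝ (Fin n) →L[ℝ] EuclideanSpace ℝ (Fin n)
  N : EuclideanSpace ℝ (Fin n) →L[ℝ] EuclideanSpace ℝ (Fin n)
  a : Fin n → ℝ
  p : Fin n → ℝ
  ρ : ℝ
  γ : ℝ

namespace Model

variable {n : ℕ} (m : Model n)

/-- The operator `L + A`, where `A = diag a`. -/
def drift : EuclideanSpace ℝ (Fin n) →L[ℝ] EuclideanSpace ℝ (Fin n) :=
  m.L + Matrix.toEuclideanCLM (n := Fin n) (𝕜 := ℝ) (Matrix.diagonal m.a)

/-- The capital path: the solution of `K' = (L + A) K - N C`, `K 0 = k`, given by the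
variation of constants formula (for `t ≥ 0`). -/
def capital (k : EuclideanSpace ℝ (Fin n)) (C : ℝ → EuclideanSpace ℝ (Fin n)) (t : ℝ) :
    EuclideanSpace ℝ (Fin n) :=
  NormedSpace.exp (t • m.drift) k
    - ∫ s in (0 : ℝ)..t, NormedSpace.exp ((t - s) • m.drift) (m.N (C s))

/-- The admissible controls for the initial state `k`: locally integrable on `[0, ∞)`, with values
in the closed orthant, and keeping capital in the closed orthant. -/
def admissible (k : EuclideanSpace ℝ (Fin n)) : Set (ℝ → EuclideanSpace ℝ (Fin n)) :=
  {C | LocallyIntegrableOn C (Set.Ici 0) ∧ (∀ t, 0 ≤ t → C t ∈ orthant n) ∧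
    ∀ t, 0 ≤ t → m.capital k C t ∈ orthant n}

/-- The utility `u_γ` on `[0, ∞)`, with value `-∞` at `0` if `1 ≤ γ`. -/
def utility (x : ℝ) : EReal :=
  if 1 ≤ m.γ ∧ x = 0 then ⊥
  else if m.γ = 1 then ((Real.log x : ℝ) : EReal)
  else ((x ^ (1 - m.γ) / (1 - m.γ) : ℝ) : EReal)

/-- The aggregate utility `U_γ c = ∑ i, p i * u_γ (c i)`. -/
def totalUtility (c : EuclideanSpace ℝ (Fin n)) : EReal :=
  ∑ i, (m.p i : EReal) * m.utility (c i)

/-- The discounted utility at time `t` along the control `C`. -/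
def discounted (C : ℝ → EuclideanSpace ℝ (Fin n)) (t : ℝ) : EReal :=
  ((Real.exp (-m.ρ * t) : ℝ) : EReal) * m.totalUtility (C t)

/-- The gain functional, the extended real integral of the discounted utility over `[0, ∞)`, as
the integral of the positive part minus the integral of the negative part. -/
def gain (C : ℝ → EuclideanSpace ℝ (Fin n)) : EReal :=
  ((∫⁻ t in Set.Ici (0 : ℝ), (m.discounted C t).toENNReal : ENNReal) : EReal)
    - ((∫⁻ t in Set.Ici (0 : ℝ), (-(m.discounted C t)).toENNReal : ENNReal) : EReal)

/-- The value function, as an extended real. -/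
def value (k : EuclideanSpace ℝ (Fin n)) : EReal := ⨆ C ∈ m.admissible k, m.gain C

/-- The value function as a real function, meaningful where `value` is finite. -/
def valueReal (k : EuclideanSpace ℝ (Fin n)) : ℝ := (m.value k).toReal

/-- `C` is an optimal control for the initial state `k`. -/
def IsOptimal (k : EuclideanSpace ℝ (Fin n)) (C : ℝ → EuclideanSpace ℝ (Fin n)) : Prop :=
  C ∈ m.admissible k ∧ m.gain C = m.value k

/-- The set of times at which the capital path lies in the strictly positive orthant. -/
def interiorTimes (k : EuclideanSpace ℝ (Fin n)) (C : ℝ → EuclideanSpace ℝ (Fin n)) : Set ℝ :=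
  {t | 0 ≤ t ∧ m.capital k C t ∈ openOrthant n}

/-- The quantity `-⟨N c, q⟩ + U_γ c`, whose supremum over `c` in the closed orthant is the
Hamiltonian at `q`. -/
def hamiltonianObjective (q c : EuclideanSpace ℝ (Fin n)) : EReal :=
  ((-(inner ℝ (m.N c) q) : ℝ) : EReal) + m.totalUtility c

/-- The map `ĉ`, with components `(p i / [Nᵀ q] i) ^ (1 / γ)`. -/
def feedback (q : EuclideanSpace ℝ (Fin n)) : EuclideanSpace ℝ (Fin n) :=
  WithLp.toLp 2 fun i => (m.p i / (ContinuousLinearMap.adjoint m.N q) i) ^ (1 / m.γ)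

end Model

/-- The superdifferential at `k` of a function `v` on the set `E`: the vectors `q` with
`limsup (v x - v k - ⟨q, x - k⟩) / ‖x - k‖ ≤ 0` as `x → k` in `E`. -/
def superdifferential {n : ℕ} (E : Set (EuclideanSpace ℝ (Fin n)))
    (v : EuclideanSpace ℝ (Fin n) → ℝ) (k : EuclideanSpace ℝ (Fin n)) :
    Set (EuclideanSpace ℝ (Fin n)) :=
  {q | ∀ ε > 0, ∀ᶠ x in 𝓝[E] k, v x - v k - inner ℝ q (x - k) ≤ ε * ‖x - k‖}

end GrowthNetwork

end

/-! The heart is a duality argument at an interior state `x` with optimal control `S`. Let `q` be a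
supergradient of the value function `V` at `x`. Consume `φ` more of good `i` on `[0, δ]` and change
the initial capital by `y = ∫ φ(s) e^{-s(L+A)} N e_i ds`, which pays for it exactly: after `δ` the
capital path is the old one, and before `δ` it stays interior if `φ` is small. Then `V(x) + ∫
Δutility ≤ V(x+y) ≤ V(x) + ⟨q, y⟩`, that is, `∫ (Δutility - w φ) ≤ 0` with `w(s) = ⟨q, e^{-s(L+A)} N
e_i⟩`. If `φ` is a small step towards the maximizer of `c ↦ p_i e^{-ρs} u_γ(c) - w(s) c`, concavity
makes the integrand nonnegative, and positive wherever the control is not that maximizer. Hence `w >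
0` and `S_i(s) = (p_i e^{-ρs} / w(s))^{1/γ}` for a.e. `s` in `[0, δ]`
(`optimal_eq_of_supergradient`).

Tails of optimal controls are optimal (`realGain_shift_eq`), so one supergradient at time `t₀` gives
a continuous formula for the control on a whole interval of interior times. Comparing it with the
formula from a supergradient `q'` at a later time `t` identifies `Nᵀ q'` with the transported
costate (`costate_eq_adjoint`). So all supergradients at `t` share the same `Nᵀ q'`, the continuous
version of the control is `ĉ(q')`, and if `N` is injective the supergradient is unique, which for a
concave function means differentiability. Strict positivity of `Nᵀ q` at every time needs its own
argument, since the duality gives it only almost everywhere: extra capital `N e_i` finances extra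
consumption of good `i` forever (`adjoint_mem_openOrthant`).

The preliminaries make `V` finite and concave on the open orthant. The eigenvector `b` prices
consumption: its total cost at prices `e^{-λt} Nᵀ b` is at most `⟨b, k⟩`, which with a tangent bound
for `u_γ` bounds all gains above. Scaling a control of finite gain bounds `V` below at interior
states. -/

noncomputable section

namespace GrowthNetwork

/-! ### The real utility function -/

/-- The utility `u_γ` as a real function. -/
def realUtility (γ x : ℝ) : ℝ := if γ = 1 then Real.log x else x ^ (1 - γ) / (1 - γ)

/-- The domain on which `u_γ` is finite. -/
def utilityDom (γ : ℝ) : Set ℝ := {x | 0 ≤ x ∧ (1 ≤ γ → x ≠ 0)}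

lemma mem_utilityDom_of_pos {γ x : ℝ} (hx : 0 < x) : x ∈ utilityDom γ :=
  ⟨hx.le, fun _ => hx.ne'⟩

lemma hasDerivAt_realUtility {γ x : ℝ} (hx : 0 < x) :
    HasDerivAt (realUtility γ) (x ^ (-γ)) x := by
  unfold realUtility
  by_cases h : γ = 1
  · simp only [h, if_true]
    rw [Real.rpow_neg_one]
    exact Real.hasDerivAt_log hx.ne'
  · simp only [h, if_false]
    have h1 : (1 - γ) ≠ 0 := sub_ne_zero.2 (Ne.symm h)
    have := (Real.hasDerivAt_rpow_const (x := x) (p := 1 - γ) (Or.inl hx.ne')).div_const (1 - γ)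
    refine this.congr_deriv ?_
    rw [show 1 - γ - 1 = -γ by ring]
    field_simp

lemma continuousOn_realUtility (γ : ℝ) : ContinuousOn (realUtility γ) (utilityDom γ) := by
  intro x hx
  rcases hx.1.lt_or_eq with h | h
  · exact (hasDerivAt_realUtility h).continuousAt.continuousWithinAt
  · have hγ : γ < 1 := by
      by_contra hc
      exact hx.2 (not_lt.1 hc) h.symm
    unfold realUtility
    simp only [hγ.ne, if_false]
    exact ((Real.continuousAt_rpow_const x (1 - γ)
      (Or.inr (by linarith))).div_const _).continuousWithinAt

lemma utilityDom_eq_or (γ : ℝ) : utilityDom γ = Set.Ici 0 ∨ utilityDom γ = Set.Ioi 0 := by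
  by_cases h : 1 ≤ γ
  · right
    ext x
    simp only [utilityDom, h, Set.mem_ofPred_eq, Set.mem_Ioi, true_imp_iff]
    exact ⟨fun hx => lt_of_le_of_ne hx.1 hx.2.symm, fun hx => ⟨hx.le, hx.ne'⟩⟩
  · left
    ext x
    simp [utilityDom, h]

lemma convex_utilityDom (γ : ℝ) : Convex ℝ (utilityDom γ) := by
  rcases utilityDom_eq_or γ with h | h <;> rw [h]
  · exact convex_Ici 0
  · exact convex_Ioi 0

lemma measurableSet_utilityDom (γ : ℝ) : MeasurableSet (utilityDom γ) := by
  rcases utilityDom_eq_or γ with h | h <;> rw [h] <;> measurability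

lemma interior_utilityDom (γ : ℝ) : interior (utilityDom γ) = Set.Ioi 0 := by
  rcases utilityDom_eq_or γ with h | h <;> rw [h] <;> simp

lemma strictConcaveOn_realUtility {γ : ℝ} (hγ : 0 < γ) :
    StrictConcaveOn ℝ (utilityDom γ) (realUtility γ) := by
  refine StrictAntiOn.strictConcaveOn_of_deriv (convex_utilityDom γ)
    (continuousOn_realUtility γ) ?_
  rw [interior_utilityDom]
  intro x hx y hy hxy
  rw [(hasDerivAt_realUtility hx).deriv, (hasDerivAt_realUtility hy).deriv]
  exact Real.rpow_lt_rpow_of_neg hx hxy (by linarith)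

lemma measurable_realUtility (γ : ℝ) : Measurable (realUtility γ) := by
  unfold realUtility
  split_ifs <;> measurability

/-- A differentiable strictly concave function lies strictly below its tangents. -/
lemma realUtility_lt_tangent {γ x y : ℝ} (hγ : 0 < γ) (hx : x ∈ utilityDom γ) (hy : 0 < y)
    (hxy : x ≠ y) : realUtility γ x < realUtility γ y + y ^ (-γ) * (x - y) := by
  have hc := strictConcaveOn_realUtility hγ
  have hy' : y ∈ utilityDom γ := mem_utilityDom_of_pos hy
  rcases lt_or_gt_of_ne hxy with h | h
  · have := hc.lt_slope_of_hasDerivAt hx hy' h (hasDerivAt_realUtility hy)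
    rw [slope_def_field, lt_div_iff₀ (by linarith)] at this
    linarith
  · have := hc.slope_lt_of_hasDerivAt hy' hx h (hasDerivAt_realUtility hy)
    rw [slope_def_field, div_lt_iff₀ (by linarith)] at this
    linarith

lemma realUtility_le_tangent {γ x y : ℝ} (hγ : 0 < γ) (hx : x ∈ utilityDom γ) (hy : 0 < y) :
    realUtility γ x ≤ realUtility γ y + y ^ (-γ) * (x - y) := by
  by_cases h : x = y
  · simp [h]
  · exact (realUtility_lt_tangent hγ hx hy h).le

lemma realUtility_strictMonoOn (γ : ℝ) : StrictMonoOn (realUtility γ) (utilityDom γ) := by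
  refine strictMonoOn_of_deriv_pos (convex_utilityDom γ) (continuousOn_realUtility γ) ?_
  rw [interior_utilityDom]
  intro x hx
  rw [(hasDerivAt_realUtility hx).deriv]
  exact Real.rpow_pos_of_pos hx _

/-- The maximizer of `c ↦ a * u_γ c - w * c` if `0 < w`, and a larger point than `x` otherwise. -/
def target (γ a w x : ℝ) : ℝ := if w ≤ 0 then x + 1 else (a / w) ^ (1 / γ)

/-- First-order condition at the maximizer: marginal utility there is `w / a`. -/
lemma rpow_inv_rpow_neg {γ a w : ℝ} (hγ : 0 < γ) (ha : 0 < a) (hw : 0 < w) :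
    ((a / w) ^ (1 / γ)) ^ (-γ) = w / a := by
  rw [← Real.rpow_mul (by positivity), one_div, mul_neg, inv_mul_cancel₀ hγ.ne',
    Real.rpow_neg_one, inv_div]

lemma target_pos {γ a w x : ℝ} (ha : 0 < a) (hx : 0 ≤ x) : 0 < target γ a w x := by
  unfold target
  split_ifs with h
  · linarith
  · have : 0 < w := not_le.1 h
    positivity

/-- If `w ≤ 0` the objective is strictly increasing, so one unit more is a strict improvement. If `w
> 0` the tangent at the stationary point lies strictly above the utility elsewhere. -/
lemma lt_target_objective {γ a w x : ℝ} (hγ : 0 < γ) (ha : 0 < a) (hx : x ∈ utilityDom γ)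
    (hne : x ≠ target γ a w x) :
    a * realUtility γ x - w * x
      < a * realUtility γ (target γ a w x) - w * target γ a w x := by
  have hpos := target_pos (γ := γ) (w := w) ha hx.1
  by_cases h : w ≤ 0
  · have ht : target γ a w x = x + 1 := by simp [target, h]
    have h1 := realUtility_strictMonoOn γ hx (mem_utilityDom_of_pos hpos) (by rw [ht]; linarith)
    rw [ht] at h1 ⊢
    have := mul_lt_mul_of_pos_left h1 ha
    linarith
  · have hw : 0 < w := not_le.1 h
    have ht : target γ a w x = (a / w) ^ (1 / γ) := by simp [target, h]
    have h1 := realUtility_lt_tangent hγ hx hpos hne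
    have h2 : (target γ a w x) ^ (-γ) = w / a := by rw [ht, rpow_inv_rpow_neg hγ ha hw]
    rw [h2] at h1
    have h3 := mul_lt_mul_of_pos_left h1 ha
    have h4 : a * (w / a * (x - target γ a w x)) = w * (x - target γ a w x) := by
      field_simp
    linarith

/-- A bounded step from `x` towards `target γ a w x`. -/
def targetStep (γ ε a w x : ℝ) : ℝ :=
  ε * (target γ a w x - x) / (1 + |target γ a w x - x|)

lemma abs_targetStep_le {γ ε a w x : ℝ} (hε : 0 ≤ ε) : |targetStep γ ε a w x| ≤ ε := by
  unfold targetStep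
  have h : (0 : ℝ) < 1 + |target γ a w x - x| := by positivity
  rw [abs_div, abs_mul, abs_of_pos h, abs_of_nonneg hε, div_le_iff₀ h]
  nlinarith [abs_nonneg (target γ a w x - x)]

/-- The step covers the fraction `θ = ε / (1 + |target - x|)` of the way, so it is uniformly bounded
by `ε` and yet a convex combination to which concavity applies. -/
lemma targetStep_eq {γ ε a w x : ℝ} (hε : 0 < ε) (hε1 : ε ≤ 1) :
    ∃ θ : ℝ, 0 < θ ∧ θ ≤ 1 ∧ x + targetStep γ ε a w x = (1 - θ) * x + θ * target γ a w x := by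
  have h : (0 : ℝ) < 1 + |target γ a w x - x| := by positivity
  refine ⟨ε / (1 + |target γ a w x - x|), by positivity, ?_, ?_⟩
  · rw [div_le_one h]
    linarith [abs_nonneg (target γ a w x - x)]
  · unfold targetStep
    field_simp
    ring

lemma targetStep_mem {γ ε a w x : ℝ} (hε : 0 < ε) (hε1 : ε ≤ 1) (ha : 0 < a) (hx : 0 ≤ x) :
    0 < x + targetStep γ ε a w x := by
  obtain ⟨θ, h0, h1, h⟩ := targetStep_eq (γ := γ) (a := a) (w := w) (x := x) hε hε1
  rw [h]
  have := mul_pos h0 (target_pos (γ := γ) (w := w) ha hx)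
  have := mul_nonneg (sub_nonneg.2 h1) hx
  linarith

/-- By concavity along the segment to the target, at least the fraction `θ` of the strict
improvement at the target is retained. -/
lemma lt_targetStep_objective {γ ε a w x : ℝ} (hγ : 0 < γ) (hε : 0 < ε) (hε1 : ε ≤ 1)
    (ha : 0 < a) (hx : x ∈ utilityDom γ) (hne : x ≠ target γ a w x) :
    w * targetStep γ ε a w x
      < a * (realUtility γ (x + targetStep γ ε a w x) - realUtility γ x) := by
  obtain ⟨θ, h0, h1, h⟩ := targetStep_eq (γ := γ) (a := a) (w := w) (x := x) hε hε1
  have hc := (strictConcaveOn_realUtility hγ).concaveOn.2 hx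
    (mem_utilityDom_of_pos (target_pos (γ := γ) (w := w) ha hx.1)) (sub_nonneg.2 h1) h0.le
    (by ring)
  have hlt := lt_target_objective hγ ha hx hne
  have hs : targetStep γ ε a w x = θ * (target γ a w x - x) := by linarith
  simp only [smul_eq_mul] at hc
  rw [h]
  have h2 := mul_le_mul_of_nonneg_left hc ha.le
  have h3 := mul_lt_mul_of_pos_left hlt h0
  rw [hs]
  nlinarith

lemma le_targetStep_objective {γ ε a w x : ℝ} (hγ : 0 < γ) (hε : 0 < ε) (hε1 : ε ≤ 1)
    (ha : 0 < a) (hx : x ∈ utilityDom γ) :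
    w * targetStep γ ε a w x
      ≤ a * (realUtility γ (x + targetStep γ ε a w x) - realUtility γ x) := by
  by_cases hne : x = target γ a w x
  · have : targetStep γ ε a w x = 0 := by
      unfold targetStep
      rw [← hne]
      simp
    simp [this]
  · exact (lt_targetStep_objective hγ hε hε1 ha hx hne).le

/-! ### The aggregate utility as an extended real and as a real function -/

namespace Model

variable {n : ℕ} (m : Model n)

/-- The vectors at which the aggregate utility is finite. -/
def utilityDomain : Set (EuclideanSpace ℝ (Fin n)) := {c | ∀ i, c i ∈ utilityDom m.γ}

/-- The aggregate utility as a real function. -/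
def realTotalUtility (c : EuclideanSpace ℝ (Fin n)) : ℝ := ∑ i, m.p i * realUtility m.γ (c i)

/-- The discounted utility as a real function. -/
def realDiscounted (C : ℝ → EuclideanSpace ℝ (Fin n)) (t : ℝ) : ℝ :=
  Real.exp (-m.ρ * t) * m.realTotalUtility (C t)

lemma utility_of_mem {x : ℝ} (hx : x ∈ utilityDom m.γ) : m.utility x = realUtility m.γ x := by
  unfold utility realUtility
  rw [if_neg (fun h => hx.2 h.1 h.2)]
  split_ifs <;> rfl

lemma utility_of_notMem {x : ℝ} (hx0 : 0 ≤ x) (hx : x ∉ utilityDom m.γ) : m.utility x = ⊥ := by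
  unfold utility
  rw [if_pos]
  by_contra h
  exact hx ⟨hx0, fun h1 h2 => h ⟨h1, h2⟩⟩

lemma totalUtility_of_mem {c : EuclideanSpace ℝ (Fin n)} (hc : c ∈ m.utilityDomain) :
    m.totalUtility c = m.realTotalUtility c := by
  unfold totalUtility realTotalUtility
  have : ∀ s : Finset (Fin n), ∑ i ∈ s, (m.p i : EReal) * m.utility (c i)
      = ((∑ i ∈ s, m.p i * realUtility m.γ (c i) : ℝ) : EReal) := by
    intro s
    induction s using Finset.induction_on with
    | empty => simp
    | insert i s hi ih =>
      rw [Finset.sum_insert hi, Finset.sum_insert hi, ih, m.utility_of_mem (hc i)]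
      push_cast
      rfl
  exact this _

lemma totalUtility_of_notMem (hp : ∀ i, 0 < m.p i) {c : EuclideanSpace ℝ (Fin n)}
    (hc0 : c ∈ orthant n) (hc : c ∉ m.utilityDomain) : m.totalUtility c = ⊥ := by
  obtain ⟨i, hi⟩ : ∃ i, c i ∉ utilityDom m.γ := by
    by_contra h
    push Not at h
    exact hc h
  unfold totalUtility
  rw [← Finset.add_sum_erase _ _ (Finset.mem_univ i), m.utility_of_notMem (hc0 i) hi,
    EReal.coe_mul_bot_of_pos (hp i), EReal.bot_add]

lemma discounted_of_mem {C : ℝ → EuclideanSpace ℝ (Fin n)} {t : ℝ}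
    (hc : C t ∈ m.utilityDomain) : m.discounted C t = m.realDiscounted C t := by
  unfold discounted realDiscounted
  rw [m.totalUtility_of_mem hc]
  push_cast
  rfl

lemma discounted_of_notMem (hp : ∀ i, 0 < m.p i) {C : ℝ → EuclideanSpace ℝ (Fin n)} {t : ℝ}
    (hc0 : C t ∈ orthant n) (hc : C t ∉ m.utilityDomain) : m.discounted C t = ⊥ := by
  unfold discounted
  rw [m.totalUtility_of_notMem hp hc0 hc, EReal.coe_mul_bot_of_pos (Real.exp_pos _)]

lemma measurableSet_utilityDomain : MeasurableSet m.utilityDomain := by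
  have : m.utilityDomain = ⋂ i, (fun c : EuclideanSpace ℝ (Fin n) => c i) ⁻¹' utilityDom m.γ := by
    ext c
    simp [utilityDomain]
  rw [this]
  exact MeasurableSet.iInter fun i =>
    (measurableSet_utilityDom m.γ).preimage (EuclideanSpace.proj (𝕜 := ℝ) i).continuous.measurable

lemma measurable_realTotalUtility : Measurable m.realTotalUtility := by
  unfold realTotalUtility
  refine Finset.measurable_sum _ fun i _ => ?_
  exact ((measurable_realUtility m.γ).comp
    (EuclideanSpace.proj (𝕜 := ℝ) i).continuous.measurable).const_mul _

lemma convex_utilityDomain : Convex ℝ m.utilityDomain := by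
  intro x hx y hy a b ha hb hab i
  exact convex_utilityDom m.γ (hx i) (hy i) ha hb hab

lemma concaveOn_realTotalUtility (hp : ∀ i, 0 < m.p i) (hγ : 0 < m.γ) :
    ConcaveOn ℝ m.utilityDomain m.realTotalUtility := by
  refine ⟨m.convex_utilityDomain, fun x hx y hy a b ha hb hab => ?_⟩
  unfold realTotalUtility
  rw [Finset.smul_sum, Finset.smul_sum, ← Finset.sum_add_distrib]
  refine Finset.sum_le_sum fun i _ => ?_
  have := (strictConcaveOn_realUtility hγ).concaveOn.2 (hx i) (hy i) ha hb hab
  have := mul_le_mul_of_nonneg_left this (hp i).le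
  simp only [smul_eq_mul, PiLp.add_apply, PiLp.smul_apply] at this ⊢
  linarith

/-- Changing a single coordinate changes a single summand of the aggregate utility. -/
lemma realTotalUtility_add_single (c : EuclideanSpace ℝ (Fin n)) (i : Fin n) (x : ℝ) :
    m.realTotalUtility (c + EuclideanSpace.single i x)
      = m.realTotalUtility c + m.p i * (realUtility m.γ (c i + x) - realUtility m.γ (c i)) := by
  unfold realTotalUtility
  rw [← Finset.add_sum_erase _ _ (Finset.mem_univ i),
    ← Finset.add_sum_erase (a := i) _ (fun j => m.p j * realUtility m.γ (c j)) (Finset.mem_univ i)]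
  have : ∀ j ∈ Finset.univ.erase i, m.p j * realUtility m.γ ((c + EuclideanSpace.single i x) j)
      = m.p j * realUtility m.γ (c j) := by
    intro j hj
    simp [Finset.ne_of_mem_erase hj]
  rw [Finset.sum_congr rfl this]
  simp
  ring

end Model

/-! ### The orthant and positive semigroups -/

section ExpSemigroup

variable {E : Type*} [NormedAddCommGroup E] [InnerProductSpace ℝ E] [CompleteSpace E]

lemma exp_zero_smul {E : Type*} [NormedAddCommGroup E] [NormedSpace ℝ E] (D : E →L[ℝ] E) : NormedSpace.exp ((0 : ℝ) • D) = 1 := by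
  rw [zero_smul, NormedSpace.exp_zero]

lemma exp_add_smul (D : E →L[ℝ] E) (s t : ℝ) :
    NormedSpace.exp ((s + t) • D) = NormedSpace.exp (s • D) * NormedSpace.exp (t • D) := by
  let : NormedAlgebra ℚ (E →L[ℝ] E) := NormedAlgebra.restrictScalars ℚ ℝ _
  rw [add_smul]
  exact NormedSpace.exp_add_of_commute (((Commute.refl D).smul_left s).smul_right t)

/-- A multiple of the identity commutes with `D` and exponentiates to a scalar. This reduces
positivity to a generator with nonnegative entries, obtained by a large shift `μ`. -/
lemma exp_smul_eq_smul_exp (D : E →L[ℝ] E) (μ s : ℝ) :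
    NormedSpace.exp (s • D)
      = Real.exp (-(μ * s)) • NormedSpace.exp (s • (D + μ • (1 : E →L[ℝ] E))) := by
  let : NormedAlgebra ℚ (E →L[ℝ] E) := NormedAlgebra.restrictScalars ℚ ℝ _
  have h : s • D = (-(μ * s)) • (1 : E →L[ℝ] E) + s • (D + μ • (1 : E →L[ℝ] E)) := by
    rw [smul_add, smul_smul, neg_smul, mul_comm μ s]
    abel
  conv_lhs => rw [h]
  rw [NormedSpace.exp_add_of_commute (Commute.smul_left (Commute.one_left _) _)]
  have := NormedSpace.algebraMap_exp_comm (𝕂 := ℝ) (𝔸 := E →L[ℝ] E) (-(μ * s))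
  rw [Algebra.algebraMap_eq_smul_one, Algebra.algebraMap_eq_smul_one] at this
  rw [← this, Real.exp_eq_exp_ℝ, smul_mul_assoc, one_mul]

lemma hasDerivAt_exp_smul_apply (D : E →L[ℝ] E) (x : E) (t : ℝ) :
    HasDerivAt (fun s : ℝ => NormedSpace.exp (s • D) x) (D (NormedSpace.exp (t • D) x)) t :=
  ((ContinuousLinearMap.apply ℝ E x).hasFDerivAt).comp_hasDerivAt t
    (hasDerivAt_exp_smul_const' (𝕂 := ℝ) D t)

lemma continuous_exp_smul (D : E →L[ℝ] E) :
    Continuous fun t : ℝ => NormedSpace.exp (t • D) :=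
  continuous_iff_continuousAt.2 fun t => (hasDerivAt_exp_smul_const (𝕂 := ℝ) D t).continuousAt

/-- Since `b` is an eigenvector of the adjoint, `e^{-λs} ⟨b, e^{sD} x⟩` has zero derivative. -/
lemma inner_exp_smul_apply {D : E →L[ℝ] E} {lam : ℝ} {b : E}
    (hb : ContinuousLinearMap.adjoint D b = lam • b) (t : ℝ) (x : E) :
    inner ℝ b (NormedSpace.exp (t • D) x) = Real.exp (lam * t) * inner ℝ b x := by
  have hd : ∀ s : ℝ, HasDerivAt
      (fun s : ℝ => Real.exp (-lam * s) * inner ℝ b (NormedSpace.exp (s • D) x)) 0 s := by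
    intro s
    have h1 : HasDerivAt (fun s : ℝ => inner ℝ b (NormedSpace.exp (s • D) x))
        (lam * inner ℝ b (NormedSpace.exp (s • D) x)) s := by
      have := ((innerSL ℝ b).hasFDerivAt).comp_hasDerivAt s (hasDerivAt_exp_smul_apply D x s)
      refine this.congr_deriv ?_
      rw [innerSL_apply_apply, ← ContinuousLinearMap.adjoint_inner_left, hb, inner_smul_left]
      simp
    have h2 : HasDerivAt (fun s : ℝ => Real.exp (-lam * s)) (Real.exp (-lam * s) * -lam) s :=
      (hasDerivAt_const_mul (-lam)).exp
    exact (h2.mul h1).congr_deriv (by ring)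
  have hc := is_const_of_deriv_eq_zero (fun s => (hd s).differentiableAt)
    (fun s => (hd s).deriv) t 0
  simp only [mul_zero, Real.exp_zero, one_mul, exp_zero_smul, one_apply_eq_self] at hc
  rw [← hc, ← mul_assoc, ← Real.exp_add]
  simp

/-- A function which vanishes at `0` and is nonnegative to the right has nonnegative derivative
there. Applied to two distinct unit vectors it gives the sign of an off-diagonal entry. -/
lemma slope_inner_exp_nonneg {D : E →L[ℝ] E} {y x : E}
    (h : ∀ t : ℝ, 0 < t → 0 ≤ inner ℝ y (NormedSpace.exp (t • D) x)) (h0 : inner ℝ y x = 0) :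
    0 ≤ inner ℝ y (D x) := by
  have h2 := ((innerSL ℝ y).hasFDerivAt).comp_hasDerivAt 0 (hasDerivAt_exp_smul_apply D x 0)
  have h3 := h2.hasDerivWithinAt (s := Set.Ioi 0)
  rw [hasDerivWithinAt_iff_tendsto_slope' (by simp)] at h3
  simp only [exp_zero_smul, one_apply_eq_self, innerSL_apply_apply] at h3
  refine ge_of_tendsto h3 ?_
  filter_upwards [self_mem_nhdsWithin] with t ht
  have ht' : 0 < t := ht
  rw [slope_def_field]
  simp only [Function.comp_apply, exp_zero_smul, one_apply_eq_self, innerSL_apply_apply, h0,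
    sub_zero]
  exact div_nonneg (h t ht') ht'.le

end ExpSemigroup

section Orthant

variable {n : ℕ}

lemma orthant_add {x y : EuclideanSpace ℝ (Fin n)} (hx : x ∈ orthant n) (hy : y ∈ orthant n) :
    x + y ∈ orthant n := fun i => add_nonneg (hx i) (hy i)

lemma orthant_smul {c : ℝ} (hc : 0 ≤ c) {x : EuclideanSpace ℝ (Fin n)} (hx : x ∈ orthant n) :
    c • x ∈ orthant n := fun i => mul_nonneg hc (hx i)

lemma openOrthant_subset_orthant : openOrthant n ⊆ orthant n := fun _ hx i => (hx i).le

lemma openOrthant_add {x y : EuclideanSpace ℝ (Fin n)} (hx : x ∈ openOrthant n)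
    (hy : y ∈ orthant n) : x + y ∈ openOrthant n := fun i => add_pos_of_pos_of_nonneg (hx i) (hy i)

lemma isOpen_openOrthant : IsOpen (openOrthant n) := by
  have : openOrthant n = ⋂ i, (fun c : EuclideanSpace ℝ (Fin n) => c i) ⁻¹' Set.Ioi 0 := by
    ext c
    simp [openOrthant]
  rw [this]
  exact isOpen_iInter_of_finite fun i =>
    isOpen_Ioi.preimage (EuclideanSpace.proj (𝕜 := ℝ) i).continuous

lemma convex_openOrthant : Convex ℝ (openOrthant n) := by
  intro x hx y hy a b ha hb hab i
  exact convex_Ioi (0 : ℝ) (hx i) (hy i) ha hb hab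

lemma single_mem_orthant (i : Fin n) {x : ℝ} (hx : 0 ≤ x) :
    EuclideanSpace.single i x ∈ orthant n := by
  intro j
  by_cases h : j = i
  · subst h; simpa using hx
  · simp [h]

lemma inner_nonneg_of_orthant {x y : EuclideanSpace ℝ (Fin n)} (hx : x ∈ orthant n)
    (hy : y ∈ orthant n) : 0 ≤ inner ℝ x y := by
  rw [PiLp.inner_apply]
  exact Finset.sum_nonneg fun i _ => mul_nonneg (hy i) (hx i)

lemma inner_pos_of_openOrthant {x y : EuclideanSpace ℝ (Fin n)} (hx : x ∈ openOrthant n)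
    (hy : y ∈ orthant n) (hy0 : y ≠ 0) : 0 < inner ℝ x y := by
  rw [PiLp.inner_apply]
  have : ∃ i, y i ≠ 0 := by
    by_contra h
    push Not at h
    exact hy0 (by ext i; exact h i)
  obtain ⟨i, hi⟩ := this
  exact Finset.sum_pos' (fun j _ => mul_nonneg (hy j) (hx j).le)
    ⟨i, Finset.mem_univ i, mul_pos (lt_of_le_of_ne (hy i) hi.symm) (hx i)⟩

lemma euclidean_sum_single (x : EuclideanSpace ℝ (Fin n)) :
    x = ∑ j, x j • EuclideanSpace.single j (1 : ℝ) := by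
  ext i
  simp [Finset.sum_apply, Pi.single_apply]

lemma clm_apply_coord (P : EuclideanSpace ℝ (Fin n) →L[ℝ] EuclideanSpace ℝ (Fin n))
    (x : EuclideanSpace ℝ (Fin n)) (i : Fin n) :
    P x i = ∑ j, x j * P (EuclideanSpace.single j 1) i := by
  conv_lhs => rw [euclidean_sum_single x, map_sum]
  simp

lemma clm_mem_orthant {P : EuclideanSpace ℝ (Fin n) →L[ℝ] EuclideanSpace ℝ (Fin n)}
    (hP : ∀ i j, 0 ≤ P (EuclideanSpace.single j 1) i) {x : EuclideanSpace ℝ (Fin n)}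
    (hx : x ∈ orthant n) : P x ∈ orthant n := by
  intro i
  rw [clm_apply_coord]
  exact Finset.sum_nonneg fun j _ => mul_nonneg (hx j) (hP i j)

/-- All terms of the exponential series are nonnegative on the orthant, and `x` is its zeroth term.
-/
lemma exp_apply_sub_mem_orthant {P : EuclideanSpace ℝ (Fin n) →L[ℝ] EuclideanSpace ℝ (Fin n)}
    (hP : ∀ x ∈ orthant n, P x ∈ orthant n) {x : EuclideanSpace ℝ (Fin n)}
    (hx : x ∈ orthant n) : NormedSpace.exp P x - x ∈ orthant n := by
  intro i
  have h := NormedSpace.exp_series_hasSum_exp' (𝕂 := ℝ) P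
  have h2 := ((EuclideanSpace.proj (𝕜 := ℝ) i).comp
    (ContinuousLinearMap.apply ℝ _ x)).hasSum h
  have hpow : ∀ k : ℕ, (P ^ k) x ∈ orthant n := by
    intro k
    induction k with
    | zero => simpa using hx
    | succ k ih => rw [pow_succ']; exact hP _ ih
  have := sum_le_hasSum {0} (fun k _ => ?_) h2
  · simpa using this
  · exact mul_nonneg (by positivity) (hpow k i)

/-- The off-diagonal entries of the generator of a positive semigroup are nonnegative. -/
lemma offDiag_nonneg_of_exp {L : EuclideanSpace ℝ (Fin n) →L[ℝ] EuclideanSpace ℝ (Fin n)}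
    (hL : ∀ t : ℝ, 0 ≤ t → ∀ x ∈ orthant n, NormedSpace.exp (t • L) x ∈ orthant n)
    {i j : Fin n} (hij : i ≠ j) : 0 ≤ L (EuclideanSpace.single j 1) i := by
  have h := slope_inner_exp_nonneg (D := L) (y := EuclideanSpace.single i (1 : ℝ))
    (x := EuclideanSpace.single j (1 : ℝ)) (fun t ht => ?_)
    (by rw [EuclideanSpace.inner_single_left]; simp [hij])
  · rw [EuclideanSpace.inner_single_left] at h
    simpa using h
  · exact inner_nonneg_of_orthant (single_mem_orthant i zero_le_one)
      (hL t ht.le _ (single_mem_orthant j zero_le_one))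

end Orthant

/-! ### The semigroup of the drift -/

namespace Model

variable {n : ℕ} (m : Model n)

/-- The semigroup generated by the drift. -/
def flow (t : ℝ) : EuclideanSpace ℝ (Fin n) →L[ℝ] EuclideanSpace ℝ (Fin n) :=
  NormedSpace.exp (t • m.drift)

lemma flow_zero : m.flow 0 = 1 := exp_zero_smul m.drift

lemma flow_add (s t : ℝ) : m.flow (s + t) = m.flow s * m.flow t := exp_add_smul m.drift s t

lemma flow_add_apply (s t : ℝ) (x : EuclideanSpace ℝ (Fin n)) :
    m.flow (s + t) x = m.flow s (m.flow t x) := by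
  rw [flow_add]; rfl

lemma flow_neg_flow (t : ℝ) (x : EuclideanSpace ℝ (Fin n)) :
    m.flow t (m.flow (-t) x) = x := by
  rw [← flow_add_apply, add_neg_cancel, flow_zero]; rfl

lemma continuous_flow : Continuous m.flow := continuous_exp_smul m.drift

/-- The semigroup of the drift dominates a multiple of the identity. -/
lemma exists_flow_bound
    (hL : ∀ t : ℝ, 0 ≤ t → ∀ x ∈ orthant n, NormedSpace.exp (t • m.L) x ∈ orthant n) :
    ∃ μ : ℝ, ∀ s : ℝ, 0 ≤ s → ∀ x ∈ orthant n,
      m.flow s x - Real.exp (-(μ * s)) • x ∈ orthant n := by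
  -- Large enough to make the diagonal of `m.drift + μ • 1` nonnegative. Off the diagonal the drift
  -- agrees with `m.L`, whose entries there are nonnegative by positivity of its semigroup.
  set μ : ℝ := ∑ i, |m.drift (EuclideanSpace.single i 1) i| with hμ
  refine ⟨μ, fun s hs x hx => ?_⟩
  set P : EuclideanSpace ℝ (Fin n) →L[ℝ] EuclideanSpace ℝ (Fin n) := m.drift + μ • 1 with hPdef
  have hP : ∀ i j, 0 ≤ P (EuclideanSpace.single j 1) i := by
    intro i j
    by_cases hij : i = j
    · subst hij
      have h1 : |m.drift (EuclideanSpace.single i 1) i| ≤ μ :=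
        Finset.single_le_sum (f := fun i => |m.drift (EuclideanSpace.single i 1) i|)
          (fun _ _ => abs_nonneg _) (Finset.mem_univ i)
      have h2 := neg_abs_le (m.drift (EuclideanSpace.single i 1) i)
      simp [hPdef]
      linarith
    · have := offDiag_nonneg_of_exp hL hij
      simpa [hPdef, drift, hij, Ne.symm hij, Matrix.mulVec_diagonal] using this
  have hsP : ∀ x ∈ orthant n, (s • P) x ∈ orthant n := fun x hx =>
    orthant_smul hs (clm_mem_orthant hP hx)
  have h1 := exp_apply_sub_mem_orthant hsP hx
  have h2 : m.flow s = Real.exp (-(μ * s)) • NormedSpace.exp (s • P) :=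
    exp_smul_eq_smul_exp m.drift μ s
  have := orthant_smul (Real.exp_pos (-(μ * s))).le h1
  rw [smul_sub] at this
  rw [h2]
  exact this

lemma flow_mem_orthant
    (hL : ∀ t : ℝ, 0 ≤ t → ∀ x ∈ orthant n, NormedSpace.exp (t • m.L) x ∈ orthant n)
    {s : ℝ} (hs : 0 ≤ s) {x : EuclideanSpace ℝ (Fin n)} (hx : x ∈ orthant n) :
    m.flow s x ∈ orthant n := by
  obtain ⟨μ, hμ⟩ := m.exists_flow_bound hL
  have := orthant_add (hμ s hs x hx) (orthant_smul (Real.exp_pos (-(μ * s))).le hx)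
  rwa [sub_add_cancel] at this

lemma inner_flow {lam : ℝ} {b : EuclideanSpace ℝ (Fin n)}
    (hblam : ContinuousLinearMap.adjoint m.drift b = lam • b) (t : ℝ)
    (x : EuclideanSpace ℝ (Fin n)) :
    inner ℝ b (m.flow t x) = Real.exp (lam * t) * inner ℝ b x :=
  inner_exp_smul_apply hblam t x

end Model

/-! ### Capital paths -/

lemma locallyIntegrableOn_Ici_iff {E : Type*} [NormedAddCommGroup E] {f : ℝ → E} :
    LocallyIntegrableOn f (Set.Ici 0) ↔ ∀ t, 0 ≤ t → IntervalIntegrable f volume 0 t := by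
  constructor
  · intro h t ht
    rw [intervalIntegrable_iff_integrableOn_Icc_of_le ht]
    exact h.integrableOn_compact_subset (fun x hx => hx.1) isCompact_Icc
  · intro h x hx
    have hx' : (0 : ℝ) ≤ x := hx
    refine ⟨Set.Icc 0 (x + 1), ?_, ?_⟩
    · rw [mem_nhdsWithin]
      exact ⟨Set.Iio (x + 1), isOpen_Iio, by simp, fun y hy => ⟨hy.2, le_of_lt hy.1⟩⟩
    · rw [← intervalIntegrable_iff_integrableOn_Icc_of_le (by linarith)]
      exact h _ (by linarith)

lemma IntervalIntegrable.clm_apply_of_continuous {E F : Type*} [NormedAddCommGroup E]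
    [NormedSpace ℝ E] [NormedAddCommGroup F] [NormedSpace ℝ F] {G : ℝ → E →L[ℝ] F}
    (hG : Continuous G) {f : ℝ → E} {a b : ℝ} (hf : IntervalIntegrable f volume a b) :
    IntervalIntegrable (fun s => G s (f s)) volume a b := by
  obtain ⟨M, hM⟩ := (isCompact_uIcc (a := a) (b := b)).exists_bound_of_continuousOn
    hG.continuousOn
  rw [intervalIntegrable_iff] at hf ⊢
  refine Integrable.mono' (hf.norm.const_mul M) ?_ ?_
  · exact (isBoundedBilinearMap_apply (𝕜 := ℝ) (E := E) (F := F)).continuous.comp_aestronglyMeasurable₂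
      hG.aestronglyMeasurable hf.1
  · refine (ae_restrict_iff' measurableSet_uIoc).2 (ae_of_all _ fun s hs => ?_)
    refine (ContinuousLinearMap.le_opNorm _ _).trans ?_
    exact mul_le_mul_of_nonneg_right (hM s (Set.uIoc_subset_uIcc hs)) (norm_nonneg _)

lemma intervalIntegral_mem_orthant {n : ℕ} {f : ℝ → EuclideanSpace ℝ (Fin n)} {t : ℝ}
    (ht : 0 ≤ t) (hf : IntervalIntegrable f volume 0 t)
    (h : ∀ s ∈ Set.Icc 0 t, f s ∈ orthant n) : (∫ s in (0 : ℝ)..t, f s) ∈ orthant n := by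
  intro i
  have := (EuclideanSpace.proj (𝕜 := ℝ) i).intervalIntegral_comp_comm hf
  rw [show (∫ s in (0 : ℝ)..t, f s) i = EuclideanSpace.proj (𝕜 := ℝ) i (∫ s in (0 : ℝ)..t, f s)
    from rfl, ← this]
  exact intervalIntegral.integral_nonneg ht fun s hs => h s hs i

namespace Model

variable {n : ℕ} (m : Model n)

/-- The effect of consumption, transported back to time `0`. -/
def backFlow (s : ℝ) : EuclideanSpace ℝ (Fin n) →L[ℝ] EuclideanSpace ℝ (Fin n) :=
  (m.flow (-s)).comp m.N

lemma continuous_backFlow : Continuous m.backFlow :=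
  (m.continuous_flow.comp continuous_neg).clm_comp continuous_const

lemma backFlow_zero : m.backFlow 0 = m.N := by
  unfold backFlow
  rw [neg_zero, flow_zero]
  rfl

lemma backFlow_add (s t : ℝ) (c : EuclideanSpace ℝ (Fin n)) :
    m.backFlow (s + t) c = m.flow (-s) (m.backFlow t c) := by
  unfold backFlow
  rw [ContinuousLinearMap.comp_apply, neg_add, flow_add_apply]
  rfl

/-- The cumulated consumption, transported back to time `0`. -/
def consumed (C : ℝ → EuclideanSpace ℝ (Fin n)) (t : ℝ) : EuclideanSpace ℝ (Fin n) :=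
  ∫ s in (0 : ℝ)..t, m.backFlow s (C s)

variable {m}

/-- Transporting everything back to time `0` separates the invertible flow from the consumed bundle,
which is linear in the control; comparisons of paths become comparisons of `k - m.consumed C t`. -/
lemma capital_eq {k : EuclideanSpace ℝ (Fin n)} {C : ℝ → EuclideanSpace ℝ (Fin n)} {t : ℝ}
    (hC : IntervalIntegrable C volume 0 t) :
    m.capital k C t = m.flow t (k - m.consumed C t) := by
  have h := (m.flow t).intervalIntegral_comp_comm
    (IntervalIntegrable.clm_apply_of_continuous m.continuous_backFlow hC)
  rw [map_sub]
  unfold consumed capital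
  rw [← h]
  congr 1
  refine intervalIntegral.integral_congr fun s _ => ?_
  change m.flow (t - s) (m.N (C s)) = m.flow t (m.flow (-s) (m.N (C s)))
  rw [← flow_add_apply, sub_eq_add_neg]

lemma capital_zero (k : EuclideanSpace ℝ (Fin n)) (C : ℝ → EuclideanSpace ℝ (Fin n)) :
    m.capital k C 0 = k := by
  simp [capital, exp_zero_smul m.drift]

lemma consumed_congr {C C' : ℝ → EuclideanSpace ℝ (Fin n)} {t : ℝ}
    (h : ∀ s ∈ Set.uIoc 0 t, C s = C' s) : m.consumed C t = m.consumed C' t := by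
  refine intervalIntegral.integral_congr_ae (ae_of_all _ fun s hs => ?_)
  rw [h s hs]

lemma consumed_add {C C' : ℝ → EuclideanSpace ℝ (Fin n)} {t : ℝ}
    (hC : IntervalIntegrable C volume 0 t) (hC' : IntervalIntegrable C' volume 0 t) :
    m.consumed (fun s => C s + C' s) t = m.consumed C t + m.consumed C' t := by
  unfold consumed
  rw [← intervalIntegral.integral_add
    (IntervalIntegrable.clm_apply_of_continuous m.continuous_backFlow hC)
    (IntervalIntegrable.clm_apply_of_continuous m.continuous_backFlow hC')]
  simp only [map_add]

lemma consumed_smul {C : ℝ → EuclideanSpace ℝ (Fin n)} {t : ℝ} (a : ℝ) :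
    m.consumed (fun s => a • C s) t = a • m.consumed C t := by
  unfold consumed
  rw [← intervalIntegral.integral_smul]
  simp only [map_smul]

lemma capital_combination {k k' : EuclideanSpace ℝ (Fin n)}
    {C C' : ℝ → EuclideanSpace ℝ (Fin n)} {t : ℝ}
    (hC : IntervalIntegrable C volume 0 t) (hC' : IntervalIntegrable C' volume 0 t) (a b : ℝ) :
    m.capital (a • k + b • k') (fun s => a • C s + b • C' s) t
      = a • m.capital k C t + b • m.capital k' C' t := by
  have hi : IntervalIntegrable (fun s => a • C s + b • C' s) volume 0 t :=
    (hC.smul a).add (hC'.smul b)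
  rw [capital_eq hi, capital_eq hC, capital_eq hC',
    consumed_add (C := fun s => a • C s) (C' := fun s => b • C' s) (hC.smul a) (hC'.smul b),
    consumed_smul, consumed_smul, ← map_smul, ← map_smul,
    ← map_add]
  congr 1
  module

lemma consumed_shift {C : ℝ → EuclideanSpace ℝ (Fin n)} {t₀ t : ℝ}
    (h₀ : IntervalIntegrable C volume 0 t₀) (h : IntervalIntegrable C volume t₀ (t₀ + t)) :
    m.consumed C (t₀ + t)
      = m.consumed C t₀ + m.flow (-t₀) (m.consumed (fun s => C (t₀ + s)) t) := by
  have hs : IntervalIntegrable (fun s => C (t₀ + s)) volume 0 t := by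
    simpa using h.comp_add_left t₀
  unfold consumed
  rw [← intervalIntegral.integral_add_adjacent_intervals
    (IntervalIntegrable.clm_apply_of_continuous m.continuous_backFlow h₀)
    (IntervalIntegrable.clm_apply_of_continuous m.continuous_backFlow h)]
  congr 1
  rw [← (m.flow (-t₀)).intervalIntegral_comp_comm
    (IntervalIntegrable.clm_apply_of_continuous m.continuous_backFlow hs)]
  have := intervalIntegral.integral_comp_add_left (a := 0) (b := t)
    (fun s => m.backFlow s (C s)) t₀
  rw [add_zero] at this
  rw [← this]
  simp only [backFlow_add]

lemma capital_shift {k : EuclideanSpace ℝ (Fin n)} {C : ℝ → EuclideanSpace ℝ (Fin n)} {t₀ t : ℝ}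
    (h₀ : IntervalIntegrable C volume 0 t₀) (h : IntervalIntegrable C volume t₀ (t₀ + t)) :
    m.capital k C (t₀ + t) = m.capital (m.capital k C t₀) (fun s => C (t₀ + s)) t := by
  have hs : IntervalIntegrable (fun s => C (t₀ + s)) volume 0 t := by
    simpa using h.comp_add_left t₀
  rw [capital_eq (h₀.trans h), capital_eq hs, capital_eq h₀, consumed_shift h₀ h,
    add_comm t₀ t, flow_add_apply, map_sub, map_sub, map_add, flow_neg_flow, map_sub, map_sub,
    map_add, map_sub]
  abel

lemma continuousOn_capital {k : EuclideanSpace ℝ (Fin n)} {C : ℝ → EuclideanSpace ℝ (Fin n)}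
    (hC : ∀ t, 0 ≤ t → IntervalIntegrable C volume 0 t) :
    ContinuousOn (m.capital k C) (Set.Ici 0) := by
  have key : ContinuousOn (m.consumed C) (Set.Ici 0) := by
    intro t ht
    have ht' : (0 : ℝ) ≤ t := ht
    have hi := IntervalIntegrable.clm_apply_of_continuous m.continuous_backFlow
      (hC (t + 1) (by linarith))
    have := intervalIntegral.continuousOn_primitive_interval
      ((intervalIntegrable_iff' (by finiteness)).1 hi)
    rw [Set.uIcc_of_le (by linarith)] at this
    refine (this t ⟨ht', by linarith⟩).mono_of_mem_nhdsWithin ?_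
    rw [mem_nhdsWithin]
    exact ⟨Set.Iio (t + 1), isOpen_Iio, by simp, fun y hy => ⟨hy.2, le_of_lt hy.1⟩⟩
  have : ContinuousOn (fun t => m.flow t (k - m.consumed C t)) (Set.Ici 0) :=
    (m.continuous_flow.continuousOn).clm_apply (continuousOn_const.sub key)
  exact this.congr fun t ht => capital_eq (hC t ht)

lemma mem_admissible_iff {k : EuclideanSpace ℝ (Fin n)} {C : ℝ → EuclideanSpace ℝ (Fin n)} :
    C ∈ m.admissible k ↔ (∀ t, 0 ≤ t → IntervalIntegrable C volume 0 t) ∧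
      (∀ t, 0 ≤ t → C t ∈ orthant n) ∧ ∀ t, 0 ≤ t → m.capital k C t ∈ orthant n := by
  rw [← locallyIntegrableOn_Ici_iff]
  rfl

lemma intervalIntegrable_of_admissible {k : EuclideanSpace ℝ (Fin n)}
    {C : ℝ → EuclideanSpace ℝ (Fin n)} (hC : C ∈ m.admissible k) {s t : ℝ} (hs : 0 ≤ s)
    (ht : 0 ≤ t) : IntervalIntegrable C volume s t :=
  ((mem_admissible_iff.1 hC).1 s hs).symm.trans ((mem_admissible_iff.1 hC).1 t ht)

lemma shift_mem_admissible {k : EuclideanSpace ℝ (Fin n)} {C : ℝ → EuclideanSpace ℝ (Fin n)}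
    (hC : C ∈ m.admissible k) {t₀ : ℝ} (h₀ : 0 ≤ t₀) :
    (fun s => C (t₀ + s)) ∈ m.admissible (m.capital k C t₀) := by
  refine mem_admissible_iff.2 ⟨fun t ht => ?_, fun t ht => hC.2.1 _ (by linarith),
    fun t ht => ?_⟩
  · simpa using (intervalIntegrable_of_admissible hC h₀ (by linarith : 0 ≤ t₀ + t)).comp_add_left t₀
  · rw [← capital_shift (intervalIntegrable_of_admissible hC le_rfl h₀)
      (intervalIntegrable_of_admissible hC h₀ (by linarith))]
    exact hC.2.2 _ (by linarith)

/-- Follow `C` until time `t₀` and `C'` afterwards. -/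
def concat (t₀ : ℝ) (C C' : ℝ → EuclideanSpace ℝ (Fin n)) (t : ℝ) : EuclideanSpace ℝ (Fin n) :=
  if t ≤ t₀ then C t else C' (t - t₀)

lemma concat_mem_admissible {k : EuclideanSpace ℝ (Fin n)} {C C' : ℝ → EuclideanSpace ℝ (Fin n)}
    {t₀ : ℝ} (h₀ : 0 ≤ t₀) (hC : C ∈ m.admissible k)
    (hC' : C' ∈ m.admissible (m.capital k C t₀)) : concat t₀ C C' ∈ m.admissible k := by
  have heq1 : ∀ t, t ≤ t₀ → concat t₀ C C' t = C t := fun t ht => by simp [concat, ht]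
  -- Strict, because at `t₀` itself the concatenation still follows `C`; the integrals over `(0, t]`
  -- do not see this point.
  have heq2 : ∀ t, 0 < t → concat t₀ C C' (t₀ + t) = C' t := fun t ht => by simp [concat, ht]
  have hi1 : ∀ t, 0 ≤ t → t ≤ t₀ → IntervalIntegrable (concat t₀ C C') volume 0 t := by
    intro t ht htt
    refine (intervalIntegrable_of_admissible hC le_rfl ht).congr fun s hs => ?_
    rw [Set.uIoc_of_le ht] at hs
    exact (heq1 s (hs.2.trans htt)).symm
  have hi2 : ∀ t, 0 ≤ t → IntervalIntegrable (concat t₀ C C') volume t₀ (t₀ + t) := by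
    intro t ht
    have h1 := (intervalIntegrable_of_admissible hC' le_rfl ht).comp_add_left (-t₀)
    rw [show 0 - -t₀ = t₀ by ring, show t - -t₀ = t₀ + t by ring] at h1
    refine h1.congr fun s hs => ?_
    rw [Set.uIoc_of_le (by linarith)] at hs
    have := heq2 (-t₀ + s) (by linarith [hs.1])
    simpa using this.symm
  have hcap1 : ∀ t, 0 ≤ t → t ≤ t₀ → m.capital k (concat t₀ C C') t = m.capital k C t := by
    intro t ht htt
    rw [capital_eq (hi1 t ht htt), capital_eq (intervalIntegrable_of_admissible hC le_rfl ht)]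
    congr 2
    refine consumed_congr fun s hs => ?_
    rw [Set.uIoc_of_le ht] at hs
    exact heq1 s (hs.2.trans htt)
  have split : ∀ t, 0 ≤ t → t ≤ t₀ ∨ ∃ r, 0 ≤ r ∧ t = t₀ + r := by
    intro t _
    rcases le_total t t₀ with h | h
    · exact Or.inl h
    · exact Or.inr ⟨t - t₀, by linarith, by ring⟩
  refine mem_admissible_iff.2 ⟨fun t ht => ?_, fun t ht => ?_, fun t ht => ?_⟩
  · rcases split t ht with h | ⟨r, hr, rfl⟩
    · exact hi1 t ht h
    · exact (hi1 t₀ h₀ le_rfl).trans (hi2 r hr)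
  · unfold concat
    split_ifs with h
    · exact hC.2.1 t ht
    · exact hC'.2.1 _ (by linarith)
  · rcases split t ht with h | ⟨r, hr, rfl⟩
    · rw [hcap1 t ht h]
      exact hC.2.2 t ht
    · rw [capital_shift (hi1 t₀ h₀ le_rfl) (hi2 r hr), hcap1 t₀ h₀ le_rfl]
      have hs : IntervalIntegrable (fun s => concat t₀ C C' (t₀ + s)) volume 0 r := by
        simpa using (hi2 r hr).comp_add_left t₀
      have hr2 := hC'.2.2 r hr
      rw [capital_eq (intervalIntegrable_of_admissible hC' le_rfl hr)] at hr2
      rw [capital_eq hs, consumed_congr (C' := C')]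
      · exact hr2
      · intro s hs
        rw [Set.uIoc_of_le hr] at hs
        exact heq2 s hs.1

/-- A control stays admissible when the initial capital is increased. -/
lemma admissible_mono
    (hL : ∀ t : ℝ, 0 ≤ t → ∀ x ∈ orthant n, NormedSpace.exp (t • m.L) x ∈ orthant n)
    {k h : EuclideanSpace ℝ (Fin n)} (hh : h ∈ orthant n) {C : ℝ → EuclideanSpace ℝ (Fin n)}
    (hC : C ∈ m.admissible k) : C ∈ m.admissible (k + h) := by
  refine ⟨hC.1, hC.2.1, fun t ht => ?_⟩
  have := orthant_add (hC.2.2 t ht) (m.flow_mem_orthant hL ht hh)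
  have hi := intervalIntegrable_of_admissible hC le_rfl ht
  rw [capital_eq hi, ← map_add] at this
  rw [capital_eq hi, add_sub_right_comm]
  exact this

lemma combination_mem_admissible {k k' : EuclideanSpace ℝ (Fin n)}
    {C C' : ℝ → EuclideanSpace ℝ (Fin n)} (hC : C ∈ m.admissible k)
    (hC' : C' ∈ m.admissible k') {a b : ℝ} (ha : 0 ≤ a) (hb : 0 ≤ b) :
    (fun s => a • C s + b • C' s) ∈ m.admissible (a • k + b • k') := by
  refine mem_admissible_iff.2 ⟨fun t ht => ?_, fun t ht => ?_, fun t ht => ?_⟩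
  · exact ((intervalIntegrable_of_admissible hC le_rfl ht).smul a).add
      ((intervalIntegrable_of_admissible hC' le_rfl ht).smul b)
  · exact orthant_add (orthant_smul ha (hC.2.1 t ht)) (orthant_smul hb (hC'.2.1 t ht))
  · rw [capital_combination (intervalIntegrable_of_admissible hC le_rfl ht)
      (intervalIntegrable_of_admissible hC' le_rfl ht)]
    exact orthant_add (orthant_smul ha (hC.2.2 t ht)) (orthant_smul hb (hC'.2.2 t ht))

end Model

/-! ### The gain of admissible controls -/

namespace Model

variable {n : ℕ}

/-- The standing assumptions on the model. -/
structure Standing (m : Model n) (lam : ℝ) (b : EuclideanSpace ℝ (Fin n)) : Prop where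
  p_pos : ∀ i, 0 < m.p i
  γ_pos : 0 < m.γ
  positive : ∀ t : ℝ, 0 ≤ t → ∀ x ∈ orthant n, NormedSpace.exp (t • m.L) x ∈ orthant n
  N_mem : ∀ x ∈ orthant n, m.N x ∈ orthant n
  N_ne : ∀ i, m.N (EuclideanSpace.single i 1) ≠ 0
  ρ_pos : 0 < m.ρ
  b_mem : b ∈ openOrthant n
  eigen : ContinuousLinearMap.adjoint m.drift b = lam • b
  discount : lam * (1 - m.γ) < m.ρ

/-- The control has finite gain. -/
def FiniteGain (m : Model n) (C : ℝ → EuclideanSpace ℝ (Fin n)) : Prop :=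
  (∀ᵐ t ∂volume.restrict (Set.Ici (0 : ℝ)), C t ∈ m.utilityDomain) ∧
    IntegrableOn (m.realDiscounted C) (Set.Ici 0)

/-- The gain as a real number, meaningful for controls of finite gain. -/
def realGain (m : Model n) (C : ℝ → EuclideanSpace ℝ (Fin n)) : ℝ :=
  ∫ t in Set.Ici (0 : ℝ), m.realDiscounted C t

variable {m : Model n} {lam : ℝ} {b : EuclideanSpace ℝ (Fin n)}

lemma adjoint_apply_coord (P : EuclideanSpace ℝ (Fin n) →L[ℝ] EuclideanSpace ℝ (Fin n))
    (q : EuclideanSpace ℝ (Fin n)) (i : Fin n) :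
    ContinuousLinearMap.adjoint P q i = inner ℝ q (P (EuclideanSpace.single i 1)) := by
  rw [← ContinuousLinearMap.adjoint_inner_left, EuclideanSpace.inner_single_right]
  simp

lemma Standing.adjoint_b_mem (h : m.Standing lam b) :
    ContinuousLinearMap.adjoint m.N b ∈ openOrthant n := fun i => by
  rw [adjoint_apply_coord]
  exact inner_pos_of_openOrthant h.b_mem (h.N_mem _ (single_mem_orthant i zero_le_one)) (h.N_ne i)

/-- The consumption, evaluated with the discounted shadow prices given by `b`. -/
def shadowCost (m : Model n) (lam : ℝ) (b : EuclideanSpace ℝ (Fin n))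
    (C : ℝ → EuclideanSpace ℝ (Fin n)) (t : ℝ) : ℝ :=
  Real.exp (-lam * t) * inner ℝ (ContinuousLinearMap.adjoint m.N b) (C t)

/-- Pairing with the eigenvector `b` turns the backward flow into the scalar `e^{-λt}`. -/
lemma Standing.inner_backFlow (h : m.Standing lam b) (C : ℝ → EuclideanSpace ℝ (Fin n)) (t : ℝ) :
    inner ℝ b (m.backFlow t (C t)) = m.shadowCost lam b C t := by
  unfold backFlow shadowCost
  rw [ContinuousLinearMap.comp_apply, m.inner_flow h.eigen, ContinuousLinearMap.adjoint_inner_left,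
    mul_neg, neg_mul]

lemma Standing.shadowCost_nonneg (h : m.Standing lam b) {k : EuclideanSpace ℝ (Fin n)}
    {C : ℝ → EuclideanSpace ℝ (Fin n)} (hC : C ∈ m.admissible k) {t : ℝ} (ht : 0 ≤ t) :
    0 ≤ m.shadowCost lam b C t :=
  mul_nonneg (Real.exp_pos _).le
    (inner_nonneg_of_orthant (openOrthant_subset_orthant h.adjoint_b_mem) (hC.2.1 t ht))

lemma Standing.intervalIntegrable_shadowCost (h : m.Standing lam b)
    {k : EuclideanSpace ℝ (Fin n)} {C : ℝ → EuclideanSpace ℝ (Fin n)}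
    (hC : C ∈ m.admissible k) {t : ℝ} (ht : 0 ≤ t) :
    IntervalIntegrable (m.shadowCost lam b C) volume 0 t := by
  have h1 := IntervalIntegrable.clm_apply_of_continuous m.continuous_backFlow
    (intervalIntegrable_of_admissible hC le_rfl ht)
  have h2 := IntervalIntegrable.clm_apply_of_continuous
    (G := fun _ => innerSL ℝ b) continuous_const h1
  simpa only [innerSL_apply_apply, h.inner_backFlow] using h2

/-- Budget constraint: pair the nonnegative capital at time `t` with `b` and divide by `e^{λt}`. -/
lemma Standing.integral_shadowCost_le (h : m.Standing lam b) {k : EuclideanSpace ℝ (Fin n)}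
    {C : ℝ → EuclideanSpace ℝ (Fin n)} (hC : C ∈ m.admissible k) {t : ℝ} (ht : 0 ≤ t) :
    ∫ s in (0 : ℝ)..t, m.shadowCost lam b C s ≤ inner ℝ b k := by
  have hi := intervalIntegrable_of_admissible hC le_rfl ht
  have h1 := (innerSL ℝ b).intervalIntegral_comp_comm
    (IntervalIntegrable.clm_apply_of_continuous m.continuous_backFlow hi)
  simp only [innerSL_apply_apply, h.inner_backFlow] at h1
  have h2 := inner_nonneg_of_orthant (openOrthant_subset_orthant h.b_mem) (hC.2.2 t ht)
  rw [capital_eq hi, m.inner_flow h.eigen] at h2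
  have h3 := nonneg_of_mul_nonneg_right h2 (Real.exp_pos _)
  rw [inner_sub_right] at h3
  unfold consumed at h3
  rw [h1]
  linarith

lemma Standing.integrableOn_shadowCost (h : m.Standing lam b) {k : EuclideanSpace ℝ (Fin n)}
    {C : ℝ → EuclideanSpace ℝ (Fin n)} (hC : C ∈ m.admissible k) :
    IntegrableOn (m.shadowCost lam b C) (Set.Ioi 0) := by
  refine integrableOn_Ioi_of_intervalIntegral_norm_bounded (b := fun j : ℕ => (j : ℝ))
    (l := atTop) (inner ℝ b k) 0 (fun j => ?_) tendsto_natCast_atTop_atTop ?_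
  · exact (intervalIntegrable_iff_integrableOn_Ioc_of_le (Nat.cast_nonneg j)).1
      (h.intervalIntegrable_shadowCost hC (Nat.cast_nonneg j))
  · refine Eventually.of_forall fun j => ?_
    have : ∫ s in (0 : ℝ)..j, ‖m.shadowCost lam b C s‖
        = ∫ s in (0 : ℝ)..j, m.shadowCost lam b C s := by
      refine intervalIntegral.integral_congr fun s hs => ?_
      rw [Set.uIcc_of_le (Nat.cast_nonneg j)] at hs
      exact Real.norm_of_nonneg (h.shadowCost_nonneg hC hs.1)
    rw [this]
    exact h.integral_shadowCost_le hC (Nat.cast_nonneg j)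

lemma Standing.setIntegral_shadowCost_le (h : m.Standing lam b) {k : EuclideanSpace ℝ (Fin n)}
    {C : ℝ → EuclideanSpace ℝ (Fin n)} (hC : C ∈ m.admissible k) :
    ∫ t in Set.Ioi 0, m.shadowCost lam b C t ≤ inner ℝ b k :=
  le_of_tendsto (intervalIntegral_tendsto_integral_Ioi (b := fun j : ℕ => (j : ℝ)) 0
    (h.integrableOn_shadowCost hC) tendsto_natCast_atTop_atTop)
    (Eventually.of_forall fun j => h.integral_shadowCost_le hC (Nat.cast_nonneg j))

/-- The growth rate of the comparison consumption. -/
def compRate (m : Model n) (lam : ℝ) : ℝ := (lam - m.ρ) / m.γ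

/-- The discounted utility of the comparison consumption. -/
def compUtility (m : Model n) (lam : ℝ) (t : ℝ) : ℝ :=
  Real.exp (-m.ρ * t) * realUtility m.γ (Real.exp (m.compRate lam * t))

/-- For `γ ≠ 1` the exponent is `-ρ + (1-γ)(λ-ρ)/γ = (λ(1-γ) - ρ)/γ`, negative by the discount
condition. For `γ = 1` the function is a multiple of `t e^{-ρt}`. -/
lemma Standing.integrableOn_compUtility (h : m.Standing lam b) :
    IntegrableOn (m.compUtility lam) (Set.Ioi 0) := by
  unfold compUtility realUtility
  by_cases hγ : m.γ = 1
  · simp only [hγ, if_true, Real.log_exp]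
    have := (integrableOn_rpow_mul_exp_neg_mul_rpow (p := 1) (s := 1) (b := m.ρ) (by norm_num)
      one_pos h.ρ_pos).const_mul (m.compRate lam)
    refine this.congr (ae_of_all _ fun t => ?_)
    simp only [Real.rpow_one]
    ring
  · simp only [hγ, if_false]
    have hneg : -m.ρ + m.compRate lam * (1 - m.γ) < 0 := by
      unfold compRate
      have := h.γ_pos
      rw [div_mul_eq_mul_div, neg_add_lt_iff_lt_add, add_zero, div_lt_iff₀ this]
      linarith [h.discount]
    have := (integrableOn_exp_mul_Ioi hneg 0).div_const (1 - m.γ)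
    refine this.congr (ae_of_all _ fun t => ?_)
    simp only
    rw [← Real.exp_mul, add_mul, Real.exp_add]
    ring_nf

/-- A function dominating the discounted utility along a control. -/
def upperBound (m : Model n) (lam : ℝ) (b : EuclideanSpace ℝ (Fin n))
    (C : ℝ → EuclideanSpace ℝ (Fin n)) (t : ℝ) : ℝ :=
  (∑ i, m.p i) * |m.compUtility lam t|
    + (∑ i, m.p i / ContinuousLinearMap.adjoint m.N b i) * m.shadowCost lam b C t

lemma Standing.weight_le (h : m.Standing lam b) {c : EuclideanSpace ℝ (Fin n)}
    (hc : c ∈ orthant n) :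
    ∑ i, m.p i * c i ≤ (∑ i, m.p i / ContinuousLinearMap.adjoint m.N b i)
      * inner ℝ (ContinuousLinearMap.adjoint m.N b) c := by
  rw [PiLp.inner_apply, Finset.mul_sum]
  refine Finset.sum_le_sum fun i _ => ?_
  have h1 : m.p i / ContinuousLinearMap.adjoint m.N b i
      ≤ ∑ i, m.p i / ContinuousLinearMap.adjoint m.N b i :=
    Finset.single_le_sum (f := fun i => m.p i / ContinuousLinearMap.adjoint m.N b i)
      (fun j _ => div_nonneg (h.p_pos j).le (h.adjoint_b_mem j).le) (Finset.mem_univ i)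
  have h2 := h.adjoint_b_mem i
  have h3 := mul_le_mul_of_nonneg_right h1 (mul_nonneg (hc i) h2.le)
  refine le_trans (le_of_eq ?_) h3
  field_simp

/-- Bound the utility by its tangent at `y = e^{t(λ-ρ)/γ}`. The rate is chosen so that the
discounted slope `e^{-ρt} y^{-γ}` is `e^{-λt}`, the discount in the shadow cost. -/
lemma Standing.realDiscounted_le (h : m.Standing lam b) {C : ℝ → EuclideanSpace ℝ (Fin n)}
    {t : ℝ} (h0 : C t ∈ orthant n) (hdom : C t ∈ m.utilityDomain) :
    m.realDiscounted C t ≤ m.upperBound lam b C t := by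
  set y := Real.exp (m.compRate lam * t) with hy
  have hy0 : 0 < y := Real.exp_pos _
  have hyγ : Real.exp (-m.ρ * t) * y ^ (-m.γ) = Real.exp (-lam * t) := by
    rw [hy, ← Real.exp_mul, ← Real.exp_add]
    congr 1
    unfold compRate
    have := h.γ_pos.ne'
    field_simp
    ring
  have h1 : m.realTotalUtility (C t)
      ≤ ∑ i, m.p i * (realUtility m.γ y + y ^ (-m.γ) * C t i) := by
    refine Finset.sum_le_sum fun i _ => mul_le_mul_of_nonneg_left ?_ (h.p_pos i).le
    have := realUtility_le_tangent h.γ_pos (hdom i) hy0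
    have := mul_pos (Real.rpow_pos_of_pos hy0 (-m.γ)) hy0
    linarith
  have h2 := mul_le_mul_of_nonneg_left h1 (Real.exp_pos (-m.ρ * t)).le
  have h3 : Real.exp (-m.ρ * t) * ∑ i, m.p i * (realUtility m.γ y + y ^ (-m.γ) * C t i)
      = (∑ i, m.p i) * m.compUtility lam t + Real.exp (-lam * t) * ∑ i, m.p i * C t i := by
    rw [← hyγ]
    unfold compUtility
    rw [← hy, Finset.mul_sum, Finset.mul_sum, Finset.sum_mul, ← Finset.sum_add_distrib]
    refine Finset.sum_congr rfl fun i _ => ?_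
    ring
  have h4 := mul_le_mul_of_nonneg_left (h.weight_le h0) (Real.exp_pos (-lam * t)).le
  have h5 := mul_le_mul_of_nonneg_left (le_abs_self (m.compUtility lam t))
    (Finset.sum_nonneg fun i (_ : i ∈ Finset.univ) => (h.p_pos i).le)
  unfold upperBound shadowCost
  unfold realDiscounted
  linarith

lemma Standing.integrableOn_upperBound (h : m.Standing lam b) {k : EuclideanSpace ℝ (Fin n)}
    {C : ℝ → EuclideanSpace ℝ (Fin n)} (hC : C ∈ m.admissible k) :
    IntegrableOn (m.upperBound lam b C) (Set.Ici 0) := by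
  rw [integrableOn_Ici_iff_integrableOn_Ioi (by finiteness)]
  exact (h.integrableOn_compUtility.abs.const_mul _).add
    ((h.integrableOn_shadowCost hC).const_mul _)

/-- A bound for the gain of all controls which are admissible for `k`. -/
def gainBound (m : Model n) (lam : ℝ) (b : EuclideanSpace ℝ (Fin n))
    (k : EuclideanSpace ℝ (Fin n)) : ℝ :=
  (∑ i, m.p i) * (∫ t in Set.Ioi 0, |m.compUtility lam t|)
    + (∑ i, m.p i / ContinuousLinearMap.adjoint m.N b i) * inner ℝ b k

lemma Standing.setIntegral_upperBound_le (h : m.Standing lam b)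
    {k : EuclideanSpace ℝ (Fin n)} {C : ℝ → EuclideanSpace ℝ (Fin n)}
    (hC : C ∈ m.admissible k) :
    ∫ t in Set.Ici 0, m.upperBound lam b C t ≤ m.gainBound lam b k := by
  rw [integral_Ici_eq_integral_Ioi]
  unfold upperBound gainBound
  rw [integral_add (h.integrableOn_compUtility.abs.const_mul _)
    ((h.integrableOn_shadowCost hC).const_mul _), integral_const_mul, integral_const_mul]
  have := mul_le_mul_of_nonneg_left (h.setIntegral_shadowCost_le hC)
    (Finset.sum_nonneg fun i (_ : i ∈ Finset.univ) =>
      div_nonneg (h.p_pos i).le (h.adjoint_b_mem i).le)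
  linarith

lemma aestronglyMeasurable_realDiscounted {C : ℝ → EuclideanSpace ℝ (Fin n)}
    (hC : LocallyIntegrableOn C (Set.Ici 0)) :
    AEStronglyMeasurable (m.realDiscounted C) (volume.restrict (Set.Ici 0)) := by
  have h1 := (m.measurable_realTotalUtility.comp_aemeasurable
    hC.aestronglyMeasurable.aemeasurable)
  have h2 : Measurable fun t : ℝ => Real.exp (-m.ρ * t) := by fun_prop
  exact (h2.aemeasurable.mul h1).aestronglyMeasurable

lemma gain_of_finiteGain {C : ℝ → EuclideanSpace ℝ (Fin n)} (hC : m.FiniteGain C) :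
    m.gain C = m.realGain C := by
  unfold gain realGain
  have h1 : ∫⁻ t in Set.Ici (0 : ℝ), (m.discounted C t).toENNReal
      = ∫⁻ t in Set.Ici (0 : ℝ), ENNReal.ofReal (m.realDiscounted C t) := by
    refine lintegral_congr_ae ?_
    filter_upwards [hC.1] with t ht
    rw [m.discounted_of_mem ht, EReal.real_coe_toENNReal]
  have h2 : ∫⁻ t in Set.Ici (0 : ℝ), (-(m.discounted C t)).toENNReal
      = ∫⁻ t in Set.Ici (0 : ℝ), ENNReal.ofReal (-m.realDiscounted C t) := by
    refine lintegral_congr_ae ?_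
    filter_upwards [hC.1] with t ht
    rw [m.discounted_of_mem ht, ← EReal.coe_neg, EReal.real_coe_toENNReal]
  rw [h1, h2, integral_eq_lintegral_pos_part_sub_lintegral_neg_part hC.2, EReal.coe_sub,
    EReal.coe_ennreal_toReal hC.2.lintegral_lt_top.ne,
    EReal.coe_ennreal_toReal (Integrable.lintegral_lt_top (f := fun t => -m.realDiscounted C t)
      hC.2.neg).ne]

/-- Admissible controls have an integrable upper bound in any case, so only a lower bound has to be
supplied. -/
lemma Standing.finiteGain_of_le (h : m.Standing lam b) {k : EuclideanSpace ℝ (Fin n)}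
    {C : ℝ → EuclideanSpace ℝ (Fin n)} (hC : C ∈ m.admissible k)
    (hdom : ∀ᵐ t ∂volume.restrict (Set.Ici (0 : ℝ)), C t ∈ m.utilityDomain) {g : ℝ → ℝ}
    (hg : IntegrableOn g (Set.Ici 0))
    (hle : ∀ᵐ t ∂volume.restrict (Set.Ici (0 : ℝ)), g t ≤ m.realDiscounted C t) :
    m.FiniteGain C := by
  refine ⟨hdom, Integrable.mono' (hg.abs.add (h.integrableOn_upperBound hC).abs)
    (aestronglyMeasurable_realDiscounted hC.1) ?_⟩
  filter_upwards [hdom, hle, ae_restrict_mem measurableSet_Ici] with t h1 h2 h3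
  have h4 := h.realDiscounted_le (hC.2.1 t h3) h1
  rw [Real.norm_eq_abs, abs_le]
  have := neg_abs_le (g t)
  have := le_abs_self (m.upperBound lam b C t)
  have := abs_nonneg (g t)
  have := abs_nonneg (m.upperBound lam b C t)
  simp only [Pi.add_apply]
  constructor <;> linarith

/-- In `EReal` the gain is `⊥` as soon as the negative part has infinite integral, since `⊤ - ⊤ =
⊥`. Hence here the negative part is integrable, and it serves as the lower bound in
`finiteGain_of_le`. -/
lemma Standing.finiteGain_of_gain_ne_bot (h : m.Standing lam b)
    {k : EuclideanSpace ℝ (Fin n)} {C : ℝ → EuclideanSpace ℝ (Fin n)}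
    (hC : C ∈ m.admissible k) (hgain : m.gain C ≠ ⊥) : m.FiniteGain C := by
  classical
  -- The value `⊤` records utility `-∞`, so a finite integral forces the control into the domain
  -- almost everywhere.
  set F : ℝ → ENNReal := fun t =>
    if C t ∈ m.utilityDomain then ENNReal.ofReal (-m.realDiscounted C t) else ⊤ with hF
  have hFeq : ∫⁻ t in Set.Ici (0 : ℝ), (-(m.discounted C t)).toENNReal
      = ∫⁻ t in Set.Ici (0 : ℝ), F t := by
    refine setLIntegral_congr_fun measurableSet_Ici fun t ht => ?_
    by_cases hd : C t ∈ m.utilityDomain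
    · simp only [hF, hd, if_true]
      rw [m.discounted_of_mem hd, ← EReal.coe_neg, EReal.real_coe_toENNReal]
    · simp only [hF, hd, if_false]
      rw [m.discounted_of_notMem h.p_pos (hC.2.1 t ht) hd, EReal.neg_bot, EReal.toENNReal_top]
  have hFtop : ∫⁻ t in Set.Ici (0 : ℝ), F t ≠ ⊤ := by
    intro htop
    apply hgain
    unfold gain
    rw [hFeq, htop, EReal.coe_ennreal_top, sub_eq_add_neg, EReal.neg_top, EReal.add_bot]
  have hFm : AEMeasurable F (volume.restrict (Set.Ici 0)) := by
    have hG : Measurable fun x : ℝ × EuclideanSpace ℝ (Fin n) =>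
        if x.2 ∈ m.utilityDomain
        then ENNReal.ofReal (-(Real.exp (-m.ρ * x.1) * m.realTotalUtility x.2)) else ⊤ := by
      refine Measurable.ite (measurable_snd m.measurableSet_utilityDomain) ?_ measurable_const
      have := m.measurable_realTotalUtility
      fun_prop
    exact hG.comp_aemeasurable
      (aemeasurable_id.prodMk hC.1.aestronglyMeasurable.aemeasurable)
  have hdom : ∀ᵐ t ∂volume.restrict (Set.Ici (0 : ℝ)), C t ∈ m.utilityDomain := by
    filter_upwards [ae_lt_top' hFm hFtop] with t ht
    by_contra hd
    simp [hF, hd] at ht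
  have hneg : Integrable (fun t => max (-m.realDiscounted C t) 0)
      (volume.restrict (Set.Ici 0)) := by
    have hmeas : AEStronglyMeasurable (fun t => max (-m.realDiscounted C t) 0)
        (volume.restrict (Set.Ici 0)) :=
      ((aestronglyMeasurable_realDiscounted hC.1).neg.aemeasurable.max
        aemeasurable_const).aestronglyMeasurable
    refine (lintegral_ofReal_ne_top_iff_integrable hmeas
      (ae_of_all _ fun t => le_max_right _ _)).1 ?_
    refine ne_of_eq_of_ne (lintegral_congr_ae ?_) hFtop
    filter_upwards [hdom] with t ht
    simp [hF, ht]
  refine h.finiteGain_of_le hC hdom hneg.neg (ae_of_all _ fun t => ?_)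
  have := le_max_left (-m.realDiscounted C t) 0
  simp only [Pi.neg_apply]
  linarith

lemma Standing.realGain_le (h : m.Standing lam b) {k : EuclideanSpace ℝ (Fin n)}
    {C : ℝ → EuclideanSpace ℝ (Fin n)} (hC : C ∈ m.admissible k) (hf : m.FiniteGain C) :
    m.realGain C ≤ m.gainBound lam b k := by
  refine le_trans (integral_mono_ae hf.2 (h.integrableOn_upperBound hC) ?_)
    (h.setIntegral_upperBound_le hC)
  filter_upwards [hf.1, ae_restrict_mem measurableSet_Ici] with t h1 h3
  exact h.realDiscounted_le (hC.2.1 t h3) h1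

lemma Standing.value_ne_top (h : m.Standing lam b) (k : EuclideanSpace ℝ (Fin n)) :
    m.value k ≠ ⊤ := by
  refine ne_top_of_le_ne_top (EReal.coe_ne_top (m.gainBound lam b k)) ?_
  refine iSup₂_le fun C hC => ?_
  by_cases hg : m.gain C = ⊥
  · rw [hg]; exact bot_le
  · have hf := h.finiteGain_of_gain_ne_bot hC hg
    rw [gain_of_finiteGain hf]
    exact EReal.coe_le_coe_iff.2 (h.realGain_le hC hf)

lemma value_ne_bot_of_finiteGain {k : EuclideanSpace ℝ (Fin n)}
    {C : ℝ → EuclideanSpace ℝ (Fin n)} (hC : C ∈ m.admissible k) (hf : m.FiniteGain C) :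
    m.value k ≠ ⊥ := by
  have h1 : m.gain C ≤ m.value k := le_iSup₂ (f := fun C _ => m.gain C) C hC
  rw [gain_of_finiteGain hf] at h1
  exact ne_bot_of_le_ne_bot (EReal.coe_ne_bot _) h1

lemma Standing.realGain_le_valueReal (h : m.Standing lam b) {k : EuclideanSpace ℝ (Fin n)}
    {C : ℝ → EuclideanSpace ℝ (Fin n)} (hC : C ∈ m.admissible k) (hf : m.FiniteGain C) :
    m.realGain C ≤ m.valueReal k := by
  have h1 : m.gain C ≤ m.value k := le_iSup₂ (f := fun C _ => m.gain C) C hC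
  rw [gain_of_finiteGain hf,
    ← EReal.coe_toReal (h.value_ne_top k) (value_ne_bot_of_finiteGain hC hf)] at h1
  exact EReal.coe_le_coe_iff.1 h1

lemma Standing.exists_lt_realGain (h : m.Standing lam b) {k : EuclideanSpace ℝ (Fin n)}
    (hk : m.value k ≠ ⊥) {r : ℝ} (hr : r < m.valueReal k) :
    ∃ C ∈ m.admissible k, m.FiniteGain C ∧ r < m.realGain C := by
  have h1 : (r : EReal) < m.value k := by
    rw [← EReal.coe_toReal (h.value_ne_top k) hk]
    exact EReal.coe_lt_coe_iff.2 hr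
  unfold value at h1
  simp only [lt_iSup_iff] at h1
  obtain ⟨C, hC, hlt⟩ := h1
  have hf := h.finiteGain_of_gain_ne_bot hC (ne_bot_of_gt hlt)
  refine ⟨C, hC, hf, ?_⟩
  rw [gain_of_finiteGain hf] at hlt
  exact EReal.coe_lt_coe_iff.1 hlt

end Model

/-! ### The value function on the open orthant -/

lemma exists_pos_smul_le {n : ℕ} (k : EuclideanSpace ℝ (Fin n)) {y : EuclideanSpace ℝ (Fin n)}
    (hy : y ∈ openOrthant n) : ∃ α : ℝ, 0 < α ∧ y - α • k ∈ orthant n := by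
  have hc : ContinuousAt (fun α : ℝ => y - α • k) 0 := by fun_prop
  have h0 : y - (0 : ℝ) • k ∈ openOrthant n := by simpa using hy
  have h1 : ∀ᶠ α in 𝓝[>] (0 : ℝ), y - α • k ∈ openOrthant n :=
    (hc.eventually_mem (isOpen_openOrthant.mem_nhds h0)).filter_mono nhdsWithin_le_nhds
  obtain ⟨α, h2, h3⟩ := (h1.and self_mem_nhdsWithin).exists
  exact ⟨α, h3, openOrthant_subset_orthant h2⟩

lemma integrableOn_Ici_shift {f : ℝ → ℝ} {t₀ : ℝ} :
    IntegrableOn (fun s => f (t₀ + s)) (Set.Ici 0) ↔ IntegrableOn f (Set.Ici t₀) := by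
  have := (measurePreserving_add_left (volume : Measure ℝ) t₀).integrableOn_comp_preimage
    (measurableEmbedding_addLeft t₀) (f := f) (s := Set.Ici t₀)
  simpa [Set.preimage, Set.Ici, Function.comp_def] using this

lemma setIntegral_Ici_shift (f : ℝ → ℝ) (t₀ : ℝ) :
    ∫ s in Set.Ici 0, f (t₀ + s) = ∫ s in Set.Ici t₀, f s := by
  have := (measurePreserving_add_left (volume : Measure ℝ) t₀).setIntegral_preimage_emb
    (measurableEmbedding_addLeft t₀) f (Set.Ici t₀)
  simpa [Set.preimage, Set.Ici] using this

namespace Model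

variable {n : ℕ} {m : Model n} {lam : ℝ} {b : EuclideanSpace ℝ (Fin n)}

lemma smul_mem_utilityDomain {α : ℝ} (hα : 0 < α) {c : EuclideanSpace ℝ (Fin n)}
    (hc : c ∈ m.utilityDomain) : α • c ∈ m.utilityDomain := fun i =>
  ⟨mul_nonneg hα.le (hc i).1, fun h => mul_ne_zero hα.ne' ((hc i).2 h)⟩

/-- Power utility is homogeneous and the logarithm turns scaling into a shift, so scaling acts
affinely on utilities and preserves finite gain. -/
lemma realTotalUtility_smul (m : Model n) {α : ℝ} (hα : 0 < α) : ∃ A B : ℝ,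
    ∀ c ∈ m.utilityDomain, m.realTotalUtility (α • c) = A + B * m.realTotalUtility c := by
  by_cases hγ : m.γ = 1
  · refine ⟨∑ i, m.p i * Real.log α, 1, fun c hc => ?_⟩
    unfold realTotalUtility realUtility
    simp only [hγ, if_true, one_mul]
    rw [← Finset.sum_add_distrib]
    refine Finset.sum_congr rfl fun i _ => ?_
    rw [PiLp.smul_apply, smul_eq_mul, Real.log_mul hα.ne' ((hc i).2 hγ.ge)]
    ring
  · refine ⟨0, α ^ (1 - m.γ), fun c hc => ?_⟩
    unfold realTotalUtility realUtility
    simp only [hγ, if_false, zero_add]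
    rw [Finset.mul_sum]
    refine Finset.sum_congr rfl fun i _ => ?_
    rw [PiLp.smul_apply, smul_eq_mul, Real.mul_rpow hα.le (hc i).1]
    ring

lemma Standing.integrableOn_exp (h : m.Standing lam b) :
    IntegrableOn (fun t => Real.exp (-m.ρ * t)) (Set.Ici 0) := by
  rw [integrableOn_Ici_iff_integrableOn_Ioi (by finiteness)]
  exact exp_neg_integrableOn_Ioi 0 h.ρ_pos

lemma Standing.finiteGain_smul (h : m.Standing lam b) {α : ℝ} (hα : 0 < α)
    {C : ℝ → EuclideanSpace ℝ (Fin n)} (hC : m.FiniteGain C) :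
    m.FiniteGain (fun t => α • C t) := by
  obtain ⟨A, B, hAB⟩ := m.realTotalUtility_smul hα
  refine ⟨hC.1.mono fun t ht => smul_mem_utilityDomain hα ht, ?_⟩
  refine ((h.integrableOn_exp.const_mul A).add (hC.2.const_mul B)).congr ?_
  filter_upwards [hC.1] with t ht
  unfold realDiscounted
  rw [hAB _ ht]
  simp only [Pi.add_apply]
  ring

/-- If some state has a control of finite gain, then all interior states do. -/
lemma Standing.exists_finiteGain (h : m.Standing lam b) {k : EuclideanSpace ℝ (Fin n)}
    {C : ℝ → EuclideanSpace ℝ (Fin n)} (hC : C ∈ m.admissible k) (hf : m.FiniteGain C)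
    {y : EuclideanSpace ℝ (Fin n)} (hy : y ∈ openOrthant n) :
    ∃ C' ∈ m.admissible y, m.FiniteGain C' := by
  obtain ⟨α, hα, hle⟩ := exists_pos_smul_le k hy
  refine ⟨fun t => α • C t, ?_, h.finiteGain_smul hα hf⟩
  -- The zero second coefficient leaves `α • C`, admissible for `α • k`; it stays admissible for
  -- `y`, which dominates `α • k`.
  have h1 := combination_mem_admissible hC hC hα.le (le_refl (0 : ℝ))
  simp only [zero_smul, add_zero] at h1
  have h2 := admissible_mono h.positive hle h1
  rwa [add_sub_cancel] at h2

lemma Standing.finiteGain_combination (h : m.Standing lam b) {k : EuclideanSpace ℝ (Fin n)}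
    {C C' : ℝ → EuclideanSpace ℝ (Fin n)} (hC : m.FiniteGain C) (hC' : m.FiniteGain C')
    {α β : ℝ} (hα : 0 ≤ α) (hβ : 0 ≤ β) (hαβ : α + β = 1)
    (hadm : (fun s => α • C s + β • C' s) ∈ m.admissible k) :
    m.FiniteGain (fun s => α • C s + β • C' s) ∧
      α * m.realGain C + β * m.realGain C' ≤ m.realGain (fun s => α • C s + β • C' s) := by
  have hdom : ∀ᵐ t ∂volume.restrict (Set.Ici (0 : ℝ)),
      α • C t + β • C' t ∈ m.utilityDomain := by
    filter_upwards [hC.1, hC'.1] with t h1 h2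
    exact m.convex_utilityDomain h1 h2 hα hβ hαβ
  have hle : ∀ᵐ t ∂volume.restrict (Set.Ici (0 : ℝ)),
      α * m.realDiscounted C t + β * m.realDiscounted C' t
        ≤ m.realDiscounted (fun s => α • C s + β • C' s) t := by
    filter_upwards [hC.1, hC'.1] with t h1 h2
    have := mul_le_mul_of_nonneg_left
      ((m.concaveOn_realTotalUtility h.p_pos h.γ_pos).2 h1 h2 hα hβ hαβ)
      (Real.exp_pos (-m.ρ * t)).le
    simp only [smul_eq_mul] at this
    unfold realDiscounted
    linarith
  have hint : IntegrableOn (fun t => α * m.realDiscounted C t + β * m.realDiscounted C' t)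
      (Set.Ici 0) := (hC.2.const_mul α).add (hC'.2.const_mul β)
  have hf := h.finiteGain_of_le hadm hdom hint hle
  refine ⟨hf, ?_⟩
  unfold realGain
  rw [← integral_const_mul, ← integral_const_mul, ← integral_add (hC.2.const_mul α)
    (hC'.2.const_mul β)]
  exact integral_mono_ae hint hf.2 hle

lemma Standing.value_ne_bot (h : m.Standing lam b) {k : EuclideanSpace ℝ (Fin n)}
    {C : ℝ → EuclideanSpace ℝ (Fin n)} (hC : C ∈ m.admissible k) (hf : m.FiniteGain C)
    {y : EuclideanSpace ℝ (Fin n)} (hy : y ∈ openOrthant n) : m.value y ≠ ⊥ := by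
  obtain ⟨C', hC', hf'⟩ := h.exists_finiteGain hC hf hy
  exact value_ne_bot_of_finiteGain hC' hf'

/-- Combine `ε`-optimal controls: the dynamics are linear and the utility is concave. -/
lemma Standing.concaveOn_valueReal (h : m.Standing lam b)
    (hfin : ∀ y ∈ openOrthant n, m.value y ≠ ⊥) :
    ConcaveOn ℝ (openOrthant n) m.valueReal := by
  refine ⟨convex_openOrthant, fun x hx y hy α β hα hβ hαβ => ?_⟩
  refine le_of_forall_pos_sub_le fun ε hε => ?_
  obtain ⟨C, hC, hf, hlt⟩ := h.exists_lt_realGain (hfin x hx)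
    (show m.valueReal x - ε < m.valueReal x by linarith)
  obtain ⟨C', hC', hf', hlt'⟩ := h.exists_lt_realGain (hfin y hy)
    (show m.valueReal y - ε < m.valueReal y by linarith)
  have hadm := combination_mem_admissible hC hC' hα hβ
  obtain ⟨hf'', hle⟩ := h.finiteGain_combination hf hf' hα hβ hαβ hadm
  have h1 := h.realGain_le_valueReal hadm hf''
  have h2 := mul_le_mul_of_nonneg_left hlt.le hα
  have h3 := mul_le_mul_of_nonneg_left hlt'.le hβ
  have h4 : ε = α * ε + β * ε := by rw [← add_mul, hαβ, one_mul]
  simp only [smul_eq_mul]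
  linarith

/-! ### Dynamic programming -/

lemma realDiscounted_shift (C : ℝ → EuclideanSpace ℝ (Fin n)) (t₀ s : ℝ) :
    m.realDiscounted C (t₀ + s)
      = Real.exp (-m.ρ * t₀) * m.realDiscounted (fun s => C (t₀ + s)) s := by
  unfold realDiscounted
  rw [mul_add, Real.exp_add, mul_assoc]

lemma finiteGain_shift {C : ℝ → EuclideanSpace ℝ (Fin n)} (hC : m.FiniteGain C) {t₀ : ℝ}
    (h₀ : 0 ≤ t₀) : m.FiniteGain (fun s => C (t₀ + s)) := by
  constructor
  · have h1 := (ae_restrict_iff' measurableSet_Ici).1 hC.1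
    have h2 := (measurePreserving_add_left (volume : Measure ℝ) t₀).quasiMeasurePreserving.ae h1
    refine (ae_restrict_iff' measurableSet_Ici).2 (h2.mono fun t ht ht0 => ht ?_)
    have : (0 : ℝ) ≤ t := ht0
    exact add_nonneg h₀ this
  · have h1 : IntegrableOn (m.realDiscounted C) (Set.Ici t₀) :=
      hC.2.mono_set (Set.Ici_subset_Ici.2 h₀)
    rw [← integrableOn_Ici_shift] at h1
    refine (h1.const_mul (Real.exp (m.ρ * t₀))).congr (ae_of_all _ fun s => ?_)
    simp only
    rw [realDiscounted_shift, ← mul_assoc, ← Real.exp_add]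
    simp

lemma realGain_split {C : ℝ → EuclideanSpace ℝ (Fin n)} (hC : m.FiniteGain C) {t₀ : ℝ}
    (h₀ : 0 ≤ t₀) : m.realGain C = (∫ t in Set.Ico 0 t₀, m.realDiscounted C t)
      + Real.exp (-m.ρ * t₀) * m.realGain (fun s => C (t₀ + s)) := by
  unfold realGain
  rw [← integral_const_mul]
  simp only [← realDiscounted_shift]
  rw [setIntegral_Ici_shift, ← setIntegral_union _ measurableSet_Ici
    (hC.2.mono_set Set.Ico_subset_Ici_self) (hC.2.mono_set (Set.Ici_subset_Ici.2 h₀)),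
    Set.Ico_union_Ici_eq_Ici h₀]
  rw [Set.disjoint_left]
  intro x hx hx'
  exact absurd hx.2 (not_lt.2 hx')

lemma finiteGain_congr {C C' : ℝ → EuclideanSpace ℝ (Fin n)}
    (h : ∀ᵐ t ∂volume.restrict (Set.Ici (0 : ℝ)), C t = C' t) (hC : m.FiniteGain C) :
    m.FiniteGain C' ∧ m.realGain C' = m.realGain C := by
  have h2 : m.realDiscounted C =ᵐ[volume.restrict (Set.Ici (0 : ℝ))] m.realDiscounted C' := by
    filter_upwards [h] with t ht
    simp only [realDiscounted, ht]
  refine ⟨⟨?_, hC.2.congr h2⟩, integral_congr_ae h2.symm⟩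
  filter_upwards [h, hC.1] with t h1 h3
  rwa [← h1]

lemma finiteGain_concat {C C' : ℝ → EuclideanSpace ℝ (Fin n)} (hC : m.FiniteGain C)
    (hC' : m.FiniteGain C') {t₀ : ℝ} (h₀ : 0 ≤ t₀) :
    m.FiniteGain (concat t₀ C C') ∧
      m.realGain (concat t₀ C C') = (∫ t in Set.Ico 0 t₀, m.realDiscounted C t)
        + Real.exp (-m.ρ * t₀) * m.realGain C' := by
  have hshift : ∀ᵐ s ∂volume.restrict (Set.Ici (0 : ℝ)), C' s = concat t₀ C C' (t₀ + s) := by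
    rw [← Measure.restrict_congr_set Ioi_ae_eq_Ici]
    filter_upwards [ae_restrict_mem measurableSet_Ioi] with s hs
    have : (0 : ℝ) < s := hs
    simp [concat, this]
  obtain ⟨hf', hg'⟩ := finiteGain_congr hshift hC'
  have hIco : ∀ t ∈ Set.Ico 0 t₀, m.realDiscounted C t = m.realDiscounted (concat t₀ C C') t := by
    intro t ht
    simp [realDiscounted, concat, ht.2.le]
  have hf : m.FiniteGain (concat t₀ C C') := by
    rw [FiniteGain, ← Set.Ico_union_Ici_eq_Ici h₀]
    constructor
    · rw [ae_restrict_union_iff]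
      constructor
      · filter_upwards [ae_restrict_mem measurableSet_Ico,
          ae_restrict_of_ae_restrict_of_subset Set.Ico_subset_Ici_self hC.1] with t ht h2
        simpa [concat, ht.2.le] using h2
      · have h1 := (ae_restrict_iff' measurableSet_Ici).1 hf'.1
        have h2 := (measurePreserving_add_left (volume : Measure ℝ)
          (-t₀)).quasiMeasurePreserving.ae h1
        refine (ae_restrict_iff' measurableSet_Ici).2 (h2.mono fun t ht ht0 => ?_)
        have h3 : t₀ ≤ t := ht0
        have := ht (show (0 : ℝ) ≤ -t₀ + t by linarith)
        simpa using this
    · refine IntegrableOn.union ?_ ?_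
      · exact (hC.2.mono_set Set.Ico_subset_Ici_self).congr_fun hIco measurableSet_Ico
      · rw [← integrableOn_Ici_shift]
        simp only [realDiscounted_shift]
        exact hf'.2.const_mul _
  refine ⟨hf, ?_⟩
  rw [realGain_split hf h₀, hg']
  congr 1
  exact (setIntegral_congr_fun measurableSet_Ico hIco).symm

/-- The tails of an optimal control are optimal. -/
lemma Standing.realGain_shift_eq (h : m.Standing lam b) {k : EuclideanSpace ℝ (Fin n)}
    {C : ℝ → EuclideanSpace ℝ (Fin n)} (hC : C ∈ m.admissible k) (hf : m.FiniteGain C)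
    (hopt : m.realGain C = m.valueReal k) {t₀ : ℝ} (h₀ : 0 ≤ t₀) :
    m.realGain (fun s => C (t₀ + s)) = m.valueReal (m.capital k C t₀) := by
  have hadm := shift_mem_admissible hC h₀
  have hfs := finiteGain_shift hf h₀
  refine le_antisymm (h.realGain_le_valueReal hadm hfs) (le_of_not_gt fun hlt => ?_)
  -- A better control for the later state, glued to `C` at `t₀`, would beat the optimal gain.
  obtain ⟨C', hC', hf', hlt'⟩ := h.exists_lt_realGain (value_ne_bot_of_finiteGain hadm hfs) hlt
  obtain ⟨hfc, hgc⟩ := finiteGain_concat hf hf' h₀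
  have h1 := h.realGain_le_valueReal (concat_mem_admissible h₀ hC hC') hfc
  rw [hgc, ← hopt, realGain_split hf h₀] at h1
  have := mul_lt_mul_of_pos_left hlt' (Real.exp_pos (-m.ρ * t₀))
  linarith

end Model

/-! ### Supergradients of concave functions -/

section Supergradient

variable {E : Type*} [NormedAddCommGroup E] [InnerProductSpace ℝ E]

/-- The vectors `q` such that `y ↦ f x + ⟨q, y - x⟩` dominates `f` on `s`. -/
def supergradients (s : Set E) (f : E → ℝ) (x : E) : Set E :=
  {q | ∀ y ∈ s, f y ≤ f x + inner ℝ q (y - x)}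

/-- Concavity bounds `f y - f x` by the difference quotient at `x + r • (y - x)` for small `r`,
where the local inequality holds; the factor `r` cancels and then `ε` tends to `0`. -/
lemma ConcaveOn.mem_supergradients {s t : Set E} {f : E → ℝ} (hf : ConcaveOn ℝ s f)
    (hst : s ⊆ t) {x q : E} (hx : x ∈ s)
    (hq : ∀ ε > 0, ∀ᶠ y in 𝓝[t] x, f y - f x - inner ℝ q (y - x) ≤ ε * ‖y - x‖) :
    q ∈ supergradients s f x := by
  intro y hy
  suffices h : ∀ ε > 0, f y - f x - inner ℝ q (y - x) ≤ ε * ‖y - x‖ by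
    have hlim : Tendsto (fun ε : ℝ => ε * ‖y - x‖) (𝓝[>] 0) (𝓝 0) := by
      have : ContinuousAt (fun ε : ℝ => ε * ‖y - x‖) 0 := by fun_prop
      simpa using this.tendsto.mono_left nhdsWithin_le_nhds
    have := ge_of_tendsto hlim (by filter_upwards [self_mem_nhdsWithin] with ε hε using h ε hε)
    linarith
  intro ε hε
  have hseg : ∀ r ∈ Set.Ioc (0 : ℝ) 1, x + r • (y - x) ∈ s := by
    intro r hr
    exact hf.1.add_smul_sub_mem hx hy ⟨hr.1.le, hr.2⟩
  have hlim : Tendsto (fun r : ℝ => x + r • (y - x)) (𝓝[>] 0) (𝓝[t] x) := by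
    refine tendsto_nhdsWithin_iff.2 ⟨?_, ?_⟩
    · have : ContinuousAt (fun r : ℝ => x + r • (y - x)) 0 := by fun_prop
      simpa using this.tendsto.mono_left nhdsWithin_le_nhds
    · filter_upwards [Ioc_mem_nhdsGT (zero_lt_one' ℝ)] with r hr using hst (hseg r hr)
  obtain ⟨r, h1, hr⟩ := ((hlim.eventually (hq ε hε)).and
    (Ioc_mem_nhdsGT (zero_lt_one' ℝ))).exists
  have h2 := hf.2 hx hy (sub_nonneg.2 hr.2) hr.1.le (by ring)
  have h3 : (1 - r) • x + r • y = x + r • (y - x) := by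
    rw [sub_smul, smul_sub, one_smul]; abel
  rw [h3] at h2
  simp only [add_sub_cancel_left, inner_smul_right, norm_smul, Real.norm_of_nonneg hr.1.le,
    smul_eq_mul] at h1 h2
  have h4 : r * (f y - f x - inner ℝ q (y - x)) ≤ r * (ε * ‖y - x‖) := by linarith
  exact le_of_mul_le_mul_left h4 hr.1

lemma eventually_of_mem_supergradients {s : Set E} (hs : IsOpen s) {f : E → ℝ} {x q : E}
    (hx : x ∈ s) (hq : q ∈ supergradients s f x) {ε : ℝ} (hε : 0 < ε) :
    ∀ᶠ y in 𝓝 x, f y - f x - inner ℝ q (y - x) ≤ ε * ‖y - x‖ := by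
  filter_upwards [hs.mem_nhds hx] with y hy
  have h1 := hq y hy
  have := mul_nonneg hε.le (norm_nonneg (y - x))
  linarith

variable [FiniteDimensional ℝ E]

/-- Separate `(x, f x)` from the strict hypograph, which is convex, and open because a concave
function is continuous in finite dimension. The points vertically below `(x, f x)` make the vertical
component of the functional positive, so it can be normalized. -/
lemma ConcaveOn.supergradients_nonempty {s : Set E} (hs : IsOpen s) {f : E → ℝ}
    (hf : ConcaveOn ℝ s f) {x : E} (hx : x ∈ s) : (supergradients s f x).Nonempty := by
  have hcont : ContinuousOn f s := hf.continuousOn hs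
  set S : Set (E × ℝ) := {p | p.1 ∈ s ∧ p.2 < f p.1} with hS
  have hSopen : IsOpen S := by
    have h1 : ContinuousOn (fun p : E × ℝ => f p.1 - p.2) (s ×ˢ Set.univ) :=
      (hcont.comp continuousOn_fst fun p hp => hp.1).sub continuousOn_snd
    have := h1.isOpen_inter_preimage (hs.prod isOpen_univ) isOpen_Ioi (t := Set.Ioi 0)
    convert this using 1
    ext p
    simp [hS]
  have hSconv : Convex ℝ S := hf.convex_strict_hypograph
  have hxS : (x, f x) ∉ S := fun h => lt_irrefl _ h.2
  obtain ⟨φ, hφ⟩ := geometric_hahn_banach_open_point hSconv hSopen hxS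
  have hsplit : ∀ (y : E) (r : ℝ), φ (y, r) = φ (y, 0) + r * φ (0, 1) := by
    intro y r
    rw [← smul_eq_mul, ← map_smul, ← map_add]
    simp
  have hc : 0 < φ (0, 1) := by
    have := hφ (x, f x - 1) ⟨hx, by simp⟩
    rw [hsplit x (f x - 1), hsplit x (f x)] at this
    linarith
  set ℓ : E →L[ℝ] ℝ := φ.comp (ContinuousLinearMap.inl ℝ E ℝ) with hℓ
  have hℓa : ∀ y, ℓ y = φ (y, 0) := fun y => by simp [hℓ]
  refine ⟨(InnerProductSpace.toDual ℝ E).symm (-(φ (0, 1))⁻¹ • ℓ), fun y hy => ?_⟩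
  rw [InnerProductSpace.toDual_symm_apply]
  have h1 : φ (y, 0) + f y * φ (0, 1) ≤ φ (x, 0) + f x * φ (0, 1) := by
    refine le_of_forall_pos_sub_le fun ε hε => ?_
    have hφpos : 0 < ε / φ (0, 1) := div_pos hε hc
    have := hφ (y, f y - ε / φ (0, 1)) ⟨hy, by simpa using hφpos⟩
    rw [hsplit y, hsplit x (f x)] at this
    have h2 : (f y - ε / φ (0, 1)) * φ (0, 1) = f y * φ (0, 1) - ε := by
      field_simp
    linarith
  have h3 : (-(φ (0, 1))⁻¹ • ℓ) (y - x) = (φ (0, 1))⁻¹ * (φ (x, 0) - φ (y, 0)) := by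
    rw [smul_apply, map_sub, hℓa, hℓa, smul_eq_mul]
    ring
  rw [h3]
  have h4 : f y = (φ (0, 1))⁻¹ * (f y * φ (0, 1)) := by field_simp
  have h5 : f x = (φ (0, 1))⁻¹ * (f x * φ (0, 1)) := by field_simp
  have h6 := mul_le_mul_of_nonneg_left h1 (inv_pos.2 hc).le
  rw [mul_add, mul_add, ← h4, ← h5] at h6
  rw [mul_sub]
  linarith

/-- Supergradients at nearby points are close to the supergradient at `x` if it is unique. -/
lemma ConcaveOn.eventually_supergradients_near {s : Set E} (hs : IsOpen s) {f : E → ℝ}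
    (hf : ConcaveOn ℝ s f) {x q : E} (hx : x ∈ s) (hq : supergradients s f x ⊆ {q}) {ε : ℝ}
    (hε : 0 < ε) : ∀ᶠ y in 𝓝 x, ∀ q' ∈ supergradients s f y, ‖q' - q‖ ≤ ε := by
  have hcont : ContinuousAt f x := (hf.continuousOn hs).continuousAt (hs.mem_nhds hx)
  obtain ⟨K, t, ht, hK⟩ := hf.locallyLipschitzOn hs hx
  rw [hs.nhdsWithin_eq hx] at ht
  -- A local Lipschitz constant bounds nearby supergradients: test `q'` at `y - r • q'`.
  have hbound : ∀ᶠ y in 𝓝 x, ∀ q' ∈ supergradients s f y, ‖q'‖ ≤ K := by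
    filter_upwards [eventually_mem_nhds_iff.2 ht, eventually_mem_nhds_iff.2 (hs.mem_nhds hx)]
      with y hyt hys q' hq'
    by_cases h0 : q' = 0
    · simp [h0]
    have hlim : Tendsto (fun r : ℝ => y - r • q') (𝓝[>] 0) (𝓝 y) := by
      have : ContinuousAt (fun r : ℝ => y - r • q') 0 := by fun_prop
      simpa using this.tendsto.mono_left nhdsWithin_le_nhds
    obtain ⟨r, ⟨h1, h2⟩, hr⟩ := ((hlim.eventually (inter_mem hyt hys)).and
      self_mem_nhdsWithin).exists
    have hr' : 0 < r := hr
    have h3 := hq' _ h2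
    have h4 := hK.norm_sub_le (mem_of_mem_nhds hyt) h1
    simp only [sub_sub_cancel_left, inner_neg_right, inner_smul_right,
      real_inner_self_eq_norm_sq, sub_sub_cancel, norm_smul, Real.norm_of_nonneg hr'.le] at h3 h4
    have h5 := le_abs_self (f y - f (y - r • q'))
    rw [← Real.norm_eq_abs] at h5
    have h6 : (r * ‖q'‖) * ‖q'‖ ≤ (r * ‖q'‖) * K := by nlinarith
    exact le_of_mul_le_mul_left h6 (mul_pos hr' (norm_pos_iff.2 h0))
  -- By compactness, supergradients staying `ε` away from `q` at points tending to `x` would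
  -- accumulate at a supergradient at `x` other than `q`.
  by_contra hcon
  rw [not_eventually] at hcon
  obtain ⟨y, hy, hyP⟩ := exists_seq_forall_of_frequently (hcon.and_eventually hbound)
  have h1 : ∀ j, ∃ q' ∈ supergradients s f (y j), ε < ‖q' - q‖ := by
    intro j
    have := (hyP j).1
    push Not at this
    exact this
  choose p hp hpε using h1
  obtain ⟨p', -, ψ, hψ, hlim⟩ := tendsto_subseq_of_bounded
    (Metric.isBounded_closedBall (x := (0 : E)) (r := K))
    (x := p) (fun j => by simpa using (hyP j).2 _ (hp j))
  have hyψ : Tendsto (y ∘ ψ) atTop (𝓝 x) := hy.comp hψ.tendsto_atTop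
  have hp' : p' ∈ supergradients s f x := by
    intro z hz
    have hr : Tendsto (fun j => f (y (ψ j)) + inner ℝ (p (ψ j)) (z - y (ψ j))) atTop
        (𝓝 (f x + inner ℝ p' (z - x))) :=
      (hcont.tendsto.comp hyψ).add (hlim.inner (tendsto_const_nhds.sub hyψ))
    exact ge_of_tendsto' hr fun j => hp (ψ j) z hz
  have hpq : p' = q := hq hp'
  have h2 : Tendsto (fun j => ‖p (ψ j) - q‖) atTop (𝓝 ‖p' - q‖) :=
    (hlim.sub tendsto_const_nhds).norm
  have h3 := ge_of_tendsto' h2 fun j => (hpε (ψ j)).le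
  rw [hpq, sub_self, norm_zero] at h3
  linarith

/-- The increment `f y - f x` lies between `⟨q', y - x⟩` and `⟨q, y - x⟩`, with `q'` a supergradient
at `y`; uniqueness at `x` forces `q'` to be close to `q`. -/
lemma ConcaveOn.differentiableAt_of_subsingleton {s : Set E} (hs : IsOpen s) {f : E → ℝ}
    (hf : ConcaveOn ℝ s f) {x : E} (hx : x ∈ s) (hu : (supergradients s f x).Subsingleton) :
    DifferentiableAt ℝ f x := by
  obtain ⟨q, hq⟩ := ConcaveOn.supergradients_nonempty hs hf hx
  have hsub : supergradients s f x ⊆ {q} := fun p hp => hu hp hq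
  refine HasFDerivAt.differentiableAt (f' := innerSL ℝ q) ?_
  rw [hasFDerivAt_iff_isLittleO, Asymptotics.isLittleO_iff]
  intro ε hε
  filter_upwards [ConcaveOn.eventually_supergradients_near hs hf hx hsub hε, hs.mem_nhds hx]
    with y hy hys
  obtain ⟨q', hq'⟩ := ConcaveOn.supergradients_nonempty hs hf hys
  have h1 := hq y hys
  have h2 := hq' x hx
  have h3 := (abs_real_inner_le_norm (q' - q) (y - x)).trans
    (mul_le_mul_of_nonneg_right (hy q' hq') (norm_nonneg _))
  have h4 : inner ℝ q' (x - y) = -inner ℝ q' (y - x) := by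
    rw [← inner_neg_right, neg_sub]
  rw [inner_sub_left] at h3
  have h5 := neg_le_of_abs_le h3
  rw [Real.norm_eq_abs, abs_le, innerSL_apply_apply]
  have := mul_nonneg hε.le (norm_nonneg (y - x))
  constructor <;> linarith

end Supergradient

/-! ### Perturbations of optimal controls -/

lemma measurable_targetStep (γ ε : ℝ) :
    Measurable fun z : ℝ × ℝ × ℝ => targetStep γ ε z.1 z.2.1 z.2.2 := by
  have h1 : Measurable fun z : ℝ × ℝ × ℝ => target γ z.1 z.2.1 z.2.2 := by
    unfold target
    refine Measurable.ite ?_ (by fun_prop) (by fun_prop)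
    exact measurableSet_le (by fun_prop) (by fun_prop)
  unfold targetStep
  fun_prop

namespace Model

variable {n : ℕ} {m : Model n} {lam : ℝ} {b : EuclideanSpace ℝ (Fin n)}

/-- Add `φ` to the `i`-th coordinate of the control. -/
def perturb (S : ℝ → EuclideanSpace ℝ (Fin n)) (i : Fin n) (φ : ℝ → ℝ) (s : ℝ) :
    EuclideanSpace ℝ (Fin n) := S s + EuclideanSpace.single i (φ s)

/-- The effect of a unit of consumption of type `i`, transported back to time `0`. -/
def unitEffect (m : Model n) (i : Fin n) (s : ℝ) : EuclideanSpace ℝ (Fin n) :=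
  m.backFlow s (EuclideanSpace.single i 1)

lemma continuous_unitEffect (i : Fin n) : Continuous (m.unitEffect i) :=
  m.continuous_backFlow.clm_apply continuous_const

lemma intervalIntegrable_single {φ : ℝ → ℝ} {t : ℝ} (hφ : IntervalIntegrable φ volume 0 t)
    (i : Fin n) : IntervalIntegrable (fun s => EuclideanSpace.single i (φ s)) volume 0 t := by
  have := IntervalIntegrable.clm_apply_of_continuous
    (G := fun _ => (ContinuousLinearMap.id ℝ ℝ).smulRight (EuclideanSpace.single i (1 : ℝ)))
    continuous_const hφ
  refine this.congr fun s _ => ?_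
  ext j
  by_cases h : j = i <;> simp [h]

lemma consumed_single (i : Fin n) (φ : ℝ → ℝ) (t : ℝ) :
    m.consumed (fun s => EuclideanSpace.single i (φ s)) t
      = ∫ s in (0 : ℝ)..t, φ s • m.unitEffect i s := by
  unfold consumed unitEffect
  refine intervalIntegral.integral_congr fun s _ => ?_
  simp only
  rw [← map_smul]
  congr 1
  ext j
  by_cases h : j = i <;> simp [h]

lemma intervalIntegrable_perturb {S : ℝ → EuclideanSpace ℝ (Fin n)} {φ : ℝ → ℝ} {t : ℝ}
    (hS : IntervalIntegrable S volume 0 t) (hφ : IntervalIntegrable φ volume 0 t) (i : Fin n) :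
    IntervalIntegrable (perturb S i φ) volume 0 t :=
  hS.add (intervalIntegrable_single hφ i)

lemma capital_perturb {S : ℝ → EuclideanSpace ℝ (Fin n)} {φ : ℝ → ℝ} {t : ℝ}
    (hS : IntervalIntegrable S volume 0 t) (hφ : IntervalIntegrable φ volume 0 t) (i : Fin n)
    (x h : EuclideanSpace ℝ (Fin n)) :
    m.capital (x + h) (perturb S i φ) t
      = m.capital x S t + m.flow t (h - ∫ s in (0 : ℝ)..t, φ s • m.unitEffect i s) := by
  have := consumed_add (m := m) (C := S) (C' := fun s => EuclideanSpace.single i (φ s)) hS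
    (intervalIntegrable_single hφ i)
  rw [consumed_single] at this
  rw [capital_eq (intervalIntegrable_perturb hS hφ i), capital_eq hS, ← map_add]
  congr 1
  unfold perturb
  rw [this]
  abel

/-- The change of the discounted utility caused by a perturbation. -/
def utilityChange (m : Model n) (S : ℝ → EuclideanSpace ℝ (Fin n)) (i : Fin n) (φ : ℝ → ℝ)
    (t : ℝ) : ℝ :=
  m.p i * Real.exp (-m.ρ * t) * (realUtility m.γ (S t i + φ t) - realUtility m.γ (S t i))

lemma realDiscounted_perturb (S : ℝ → EuclideanSpace ℝ (Fin n)) (i : Fin n) (φ : ℝ → ℝ)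
    (t : ℝ) : m.realDiscounted (perturb S i φ) t
      = m.realDiscounted S t + m.utilityChange S i φ t := by
  unfold realDiscounted perturb utilityChange
  rw [realTotalUtility_add_single]
  ring

lemma perturb_mem_orthant {S : ℝ → EuclideanSpace ℝ (Fin n)} {i : Fin n} {φ : ℝ → ℝ} {t : ℝ}
    (hS : S t ∈ orthant n) (h : 0 ≤ S t i + φ t) : perturb S i φ t ∈ orthant n := by
  intro j
  by_cases hj : j = i
  · subst hj; simpa [perturb] using h
  · simpa [perturb, hj] using hS j

lemma perturb_mem_utilityDomain {S : ℝ → EuclideanSpace ℝ (Fin n)} {i : Fin n} {φ : ℝ → ℝ}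
    {t : ℝ} (hS : S t ∈ m.utilityDomain) (h : S t i + φ t ∈ utilityDom m.γ) :
    perturb S i φ t ∈ m.utilityDomain := by
  intro j
  by_cases hj : j = i
  · subst hj; simpa [perturb] using h
  · simpa [perturb, hj] using hS j

/-- The value at `y` is at least the gain of an admissible perturbation. -/
lemma Standing.integral_utilityChange_le (h : m.Standing lam b)
    {S : ℝ → EuclideanSpace ℝ (Fin n)} (hf : m.FiniteGain S) {i : Fin n} {φ : ℝ → ℝ}
    {y : EuclideanSpace ℝ (Fin n)} (hadm : perturb S i φ ∈ m.admissible y)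
    (hdom : ∀ᵐ t ∂volume.restrict (Set.Ici (0 : ℝ)), S t i + φ t ∈ utilityDom m.γ) {g : ℝ → ℝ}
    (hg : IntegrableOn g (Set.Ici 0))
    (hle : ∀ᵐ t ∂volume.restrict (Set.Ici (0 : ℝ)), g t ≤ m.utilityChange S i φ t) :
    IntegrableOn (m.utilityChange S i φ) (Set.Ici 0) ∧
      m.realGain S + ∫ t in Set.Ici (0 : ℝ), m.utilityChange S i φ t ≤ m.valueReal y := by
  have hf' : m.FiniteGain (perturb S i φ) := by
    refine h.finiteGain_of_le hadm ?_ (hf.2.add hg) ?_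
    · filter_upwards [hdom, hf.1] with t h1 h2 using perturb_mem_utilityDomain h2 h1
    · filter_upwards [hle] with t ht
      rw [realDiscounted_perturb]
      simp only [Pi.add_apply]
      linarith
  have heq : m.utilityChange S i φ
      = fun t => m.realDiscounted (perturb S i φ) t - m.realDiscounted S t := by
    funext t
    rw [realDiscounted_perturb]
    ring
  have hint : IntegrableOn (m.utilityChange S i φ) (Set.Ici 0) := by
    rw [heq]
    exact hf'.2.sub hf.2
  refine ⟨hint, le_trans (le_of_eq ?_) (h.realGain_le_valueReal hadm hf')⟩
  unfold realGain
  rw [heq, integral_sub hf'.2 hf.2]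
  ring

/-- The marginal value of every consumption good is positive. -/
lemma Standing.adjoint_mem_openOrthant (h : m.Standing lam b) {x : EuclideanSpace ℝ (Fin n)}
    (hx : x ∈ openOrthant n) {S : ℝ → EuclideanSpace ℝ (Fin n)} (hS : S ∈ m.admissible x)
    (hf : m.FiniteGain S) (hopt : m.realGain S = m.valueReal x)
    {q : EuclideanSpace ℝ (Fin n)} (hq : q ∈ supergradients (openOrthant n) m.valueReal x) :
    ContinuousLinearMap.adjoint m.N q ∈ openOrthant n := by
  intro i
  obtain ⟨μ, hμ⟩ := m.exists_flow_bound h.positive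
  set v := m.N (EuclideanSpace.single i 1) with hv
  have hv0 : v ∈ orthant n := h.N_mem _ (single_mem_orthant i zero_le_one)
  -- An extra consumption of good `i` that the extra capital `v` can finance. The weights `e^{-s}`
  -- have total mass one, and `e^{-μs}` compensates for the lower bound `e^{-μs} v` on the growth of
  -- `v` under the flow.
  set φ : ℝ → ℝ := fun s => Real.exp (-s) * Real.exp (-(μ * s)) with hφ
  have hφpos : ∀ s, 0 < φ s := fun s => mul_pos (Real.exp_pos _) (Real.exp_pos _)
  have hφc : Continuous φ := by fun_prop
  have hφi : ∀ t, IntervalIntegrable φ volume 0 t := fun t => hφc.intervalIntegrable _ _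
  have hres : ∀ t, 0 ≤ t → m.flow t (v - ∫ s in (0 : ℝ)..t, φ s • m.unitEffect i s)
      ∈ orthant n := by
    intro t ht
    have hc1 : Continuous fun s => Real.exp (-s) • (v - Real.exp (-(μ * s)) • m.flow (-s) v) := by
      have h1 := m.continuous_flow
      fun_prop
    have hexp : ∫ s in (0 : ℝ)..t, Real.exp (-s) = 1 - Real.exp (-t) := by
      simp
    have hsplit : v - ∫ s in (0 : ℝ)..t, φ s • m.unitEffect i s = Real.exp (-t) • v
        + ∫ s in (0 : ℝ)..t, Real.exp (-s) • (v - Real.exp (-(μ * s)) • m.flow (-s) v) := by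
      have hc2 : Continuous fun s : ℝ => Real.exp (-s) • v := by fun_prop
      have hc3 : Continuous fun s : ℝ => φ s • m.unitEffect i s :=
        hφc.smul (continuous_unitEffect i)
      have h3 : ∫ s in (0 : ℝ)..t, Real.exp (-s) • (v - Real.exp (-(μ * s)) • m.flow (-s) v)
          = (∫ s in (0 : ℝ)..t, Real.exp (-s) • v) - ∫ s in (0 : ℝ)..t, φ s • m.unitEffect i s := by
        rw [← intervalIntegral.integral_sub (hc2.intervalIntegrable _ _)
          (hc3.intervalIntegrable _ _)]
        refine intervalIntegral.integral_congr fun s _ => ?_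
        simp only [hφ]
        rw [smul_sub, smul_smul]
        rfl
      rw [h3, intervalIntegral.integral_smul_const, hexp, sub_smul, one_smul]
      abel
    rw [hsplit, map_add, map_smul,
      ← (m.flow t).intervalIntegral_comp_comm (hc1.intervalIntegrable _ _)]
    refine orthant_add (orthant_smul (Real.exp_pos _).le (m.flow_mem_orthant h.positive ht hv0))
      (intervalIntegral_mem_orthant ht
        (((m.flow t).continuous.comp hc1).intervalIntegrable _ _) fun s hs => ?_)
    have h4 : m.flow t (Real.exp (-s) • (v - Real.exp (-(μ * s)) • m.flow (-s) v))
        = Real.exp (-s) • m.flow (t - s) (m.flow s v - Real.exp (-(μ * s)) • v) := by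
      rw [map_smul, map_sub, map_smul, map_sub, map_smul, ← flow_add_apply, ← flow_add_apply,
        sub_add_cancel, show t + -s = t - s from (sub_eq_add_neg t s).symm]
    rw [h4]
    exact orthant_smul (Real.exp_pos _).le
      (m.flow_mem_orthant h.positive (sub_nonneg.2 hs.2) (hμ s hs.1 v hv0))
  have hadm : perturb S i φ ∈ m.admissible (x + v) := by
    refine mem_admissible_iff.2 ⟨fun t ht => ?_, fun t ht => ?_, fun t ht => ?_⟩
    · exact intervalIntegrable_perturb (intervalIntegrable_of_admissible hS le_rfl ht) (hφi t) i
    · exact perturb_mem_orthant (hS.2.1 t ht) (add_nonneg (hS.2.1 t ht i) (hφpos t).le)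
    · rw [capital_perturb (intervalIntegrable_of_admissible hS le_rfl ht) (hφi t)]
      exact orthant_add (hS.2.2 t ht) (hres t ht)
  have hpos : ∀ᵐ t ∂volume.restrict (Set.Ici (0 : ℝ)), 0 < m.utilityChange S i φ t := by
    filter_upwards [hf.1, ae_restrict_mem measurableSet_Ici] with t h1 h2
    refine mul_pos (mul_pos (h.p_pos i) (Real.exp_pos _)) (sub_pos.2 ?_)
    exact realUtility_strictMonoOn m.γ (h1 i)
      (mem_utilityDom_of_pos (add_pos_of_nonneg_of_pos (hS.2.1 t h2 i) (hφpos t)))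
      (lt_add_of_pos_right _ (hφpos t))
  obtain ⟨hint, hle⟩ := h.integral_utilityChange_le hf hadm (g := fun _ => 0)
    (by
      filter_upwards [ae_restrict_mem measurableSet_Ici] with t h2
      exact mem_utilityDom_of_pos (add_pos_of_nonneg_of_pos (hS.2.1 t h2 i) (hφpos t)))
    (integrable_zero _ _ _) (hpos.mono fun t ht => ht.le)
  have hintpos : 0 < ∫ t in Set.Ici (0 : ℝ), m.utilityChange S i φ t := by
    refine lt_of_le_of_ne (integral_nonneg_of_ae (hpos.mono fun t ht => ht.le)) fun h0 => ?_
    have h1 := (integral_eq_zero_iff_of_nonneg_ae (hpos.mono fun t ht => ht.le) hint).1 h0.symm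
    have h2 : ∀ᵐ t ∂volume.restrict (Set.Ici (0 : ℝ)), False := by
      filter_upwards [h1, hpos] with t h3 h4
      exact h4.ne' h3
    rw [eventually_false_iff_eq_bot, ae_eq_bot, Measure.restrict_eq_zero] at h2
    simp at h2
  -- The strictly positive utility gain is at most `V(x+v) - V(x)`, hence at most `⟨q, v⟩`.
  have hq1 := hq (x + v) (openOrthant_add hx hv0)
  rw [add_sub_cancel_left] at hq1
  rw [adjoint_apply_coord]
  linarith

/-- Along an optimal control in the open orthant, consumption is determined by shadow prices. -/
lemma Standing.optimal_eq_of_supergradient (h : m.Standing lam b)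
    {x : EuclideanSpace ℝ (Fin n)} {S : ℝ → EuclideanSpace ℝ (Fin n)}
    (hS : S ∈ m.admissible x) (hf : m.FiniteGain S) (hopt : m.realGain S = m.valueReal x)
    {q : EuclideanSpace ℝ (Fin n)} (hq : q ∈ supergradients (openOrthant n) m.valueReal x)
    {δ : ℝ} (hδ : 0 < δ) (hin : ∀ t ∈ Set.Icc 0 δ, m.capital x S t ∈ openOrthant n)
    (i : Fin n) :
    ∀ᵐ s ∂volume.restrict (Set.Icc 0 δ), 0 < inner ℝ q (m.unitEffect i s) ∧
      S s i = (m.p i * Real.exp (-m.ρ * s) / inner ℝ q (m.unitEffect i s)) ^ (1 / m.γ) := by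
  set w : ℝ → ℝ := fun s => inner ℝ q (m.unitEffect i s) with hw
  have hwc : Continuous w := continuous_const.inner (continuous_unitEffect i)
  have ha : ∀ s, 0 < m.p i * Real.exp (-m.ρ * s) := fun s => mul_pos (h.p_pos i) (Real.exp_pos _)
  obtain ⟨M₁, hM₁⟩ := (isCompact_Icc (a := (0 : ℝ)) (b := δ)).exists_bound_of_continuousOn
    m.continuous_flow.continuousOn
  obtain ⟨M₂, hM₂⟩ := (isCompact_Icc (a := (0 : ℝ)) (b := δ)).exists_bound_of_continuousOn
    (continuous_unitEffect (m := m) i).continuousOn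
  have hM₁0 : 0 ≤ M₁ := (norm_nonneg _).trans (hM₁ 0 ⟨le_rfl, hδ.le⟩)
  have hM₂0 : 0 ≤ M₂ := (norm_nonneg _).trans (hM₂ 0 ⟨le_rfl, hδ.le⟩)
  -- By compactness, the path on `[0, δ]` keeps a uniform distance `r` from the complement of the
  -- open orthant.
  obtain ⟨r, hr, hthick⟩ : ∃ r, 0 < r ∧
      Metric.thickening r (m.capital x S '' Set.Icc 0 δ) ⊆ openOrthant n := by
    refine IsCompact.exists_thickening_subset_open ?_ isOpen_openOrthant ?_
    · exact isCompact_Icc.image_of_continuousOn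
        ((continuousOn_capital (mem_admissible_iff.1 hS).1).mono fun t ht => ht.1)
    · rintro _ ⟨t, ht, rfl⟩
      exact hin t ht
  -- A perturbation bounded by `ε` moves the capital by at most `M₁ (ε M₂ δ)` on `[0, δ]`; this
  -- choice keeps it below `r`.
  set ε : ℝ := min 1 (r / (M₁ * (M₂ * δ) + 1)) with hε
  have hden : 0 < M₁ * (M₂ * δ) + 1 := by positivity
  have hε0 : 0 < ε := lt_min one_pos (div_pos hr hden)
  have hε1 : ε ≤ 1 := min_le_left _ _
  have hεr : M₁ * (ε * M₂ * δ) < r := by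
    have h1 : ε ≤ r / (M₁ * (M₂ * δ) + 1) := min_le_right _ _
    rw [le_div_iff₀ hden] at h1
    nlinarith
  set φ : ℝ → ℝ := fun s =>
    if s ≤ δ then targetStep m.γ ε (m.p i * Real.exp (-m.ρ * s)) (w s) (S s i) else 0 with hφ
  have hφabs : ∀ s, ‖φ s‖ ≤ ε := by
    intro s
    simp only [hφ]
    split_ifs
    · exact abs_targetStep_le hε0.le
    · simpa using hε0.le
  have hφm : AEStronglyMeasurable φ (volume.restrict (Set.Ici 0)) := by
    have h1 : Measurable fun z : ℝ × ℝ => if z.1 ≤ δ then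
        targetStep m.γ ε (m.p i * Real.exp (-m.ρ * z.1)) (w z.1) z.2 else 0 := by
      refine Measurable.ite (measurableSet_le measurable_fst measurable_const) ?_ measurable_const
      have h2 : Measurable fun z : ℝ × ℝ => (m.p i * Real.exp (-m.ρ * z.1), w z.1, z.2) := by
        have := hwc.measurable
        fun_prop
      exact (measurable_targetStep m.γ ε).comp h2
    have h3 : AEMeasurable (fun s => S s i) (volume.restrict (Set.Ici 0)) :=
      (EuclideanSpace.proj (𝕜 := ℝ) i).continuous.measurable.comp_aemeasurable
        hS.1.aestronglyMeasurable.aemeasurable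
    exact (h1.comp_aemeasurable (aemeasurable_id.prodMk h3)).aestronglyMeasurable
  have hφi : ∀ t, 0 ≤ t → IntervalIntegrable φ volume 0 t := by
    intro t ht
    rw [intervalIntegrable_iff_integrableOn_Ioc_of_le ht]
    refine Integrable.mono' (g := fun _ => ε) (integrable_const ε)
      (hφm.mono_measure (Measure.restrict_mono (fun s hs => hs.1.le) le_rfl))
      (ae_of_all _ hφabs)
  have hφvi : ∀ t, 0 ≤ t → IntervalIntegrable (fun s => φ s • m.unitEffect i s) volume 0 t :=
    fun t ht => (hφi t ht).smul_continuousOn (continuous_unitEffect i).continuousOn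
  have hφout : ∀ s, δ < s → φ s = 0 := fun s hs => by simp [hφ, not_le.2 hs]
  -- The extra initial capital that pays for `φ` in advance, so that both capital paths coincide
  -- after `δ`. It may have components of either sign.
  set y := ∫ s in (0 : ℝ)..δ, φ s • m.unitEffect i s with hy
  have hSφ : ∀ s, 0 ≤ s → 0 ≤ S s i + φ s := by
    intro s hs
    simp only [hφ]
    split_ifs
    · exact (targetStep_mem hε0 hε1 (ha s) (hS.2.1 s hs i)).le
    · simpa using hS.2.1 s hs i
  have hcapin : ∀ t ∈ Set.Icc 0 δ, m.capital (x + y) (perturb S i φ) t ∈ openOrthant n := by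
    intro t ht
    rw [capital_perturb (intervalIntegrable_of_admissible hS le_rfl ht.1) (hφi t ht.1)]
    apply hthick
    refine Metric.mem_thickening_iff.2 ⟨_, ⟨t, ht, rfl⟩, ?_⟩
    rw [dist_eq_norm, add_sub_cancel_left, hy,
      intervalIntegral.integral_interval_sub_left (hφvi δ hδ.le) (hφvi t ht.1)]
    have h1 : ‖∫ s in t..δ, φ s • m.unitEffect i s‖ ≤ ε * M₂ * |δ - t| := by
      refine intervalIntegral.norm_integral_le_of_norm_le_const fun s hs => ?_
      rw [Set.uIoc_of_le ht.2] at hs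
      rw [norm_smul]
      exact mul_le_mul (hφabs s) (hM₂ s ⟨ht.1.trans hs.1.le, hs.2⟩) (norm_nonneg _) hε0.le
    have h2 : |δ - t| ≤ δ := by
      rw [abs_of_nonneg (sub_nonneg.2 ht.2)]
      linarith [ht.1]
    have h3 := h1.trans (mul_le_mul_of_nonneg_left h2 (mul_nonneg hε0.le hM₂0))
    refine lt_of_le_of_lt ((ContinuousLinearMap.le_opNorm _ _).trans ?_) hεr
    exact mul_le_mul (hM₁ t ht) h3 (norm_nonneg _) hM₁0
  have hcapout : ∀ t, δ < t → m.capital (x + y) (perturb S i φ) t = m.capital x S t := by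
    intro t ht
    have ht0 : 0 ≤ t := hδ.le.trans ht.le
    rw [capital_perturb (intervalIntegrable_of_admissible hS le_rfl ht0) (hφi t ht0), hy,
      intervalIntegral.integral_interval_sub_left (hφvi δ hδ.le) (hφvi t ht0)]
    have h1 : ∫ s in t..δ, φ s • m.unitEffect i s = 0 := by
      rw [intervalIntegral.integral_symm, neg_eq_zero]
      refine intervalIntegral.integral_zero_ae (ae_of_all _ fun s hs => ?_)
      rw [Set.uIoc_of_le ht.le] at hs
      rw [hφout s hs.1, zero_smul]
    rw [h1, map_zero, add_zero]
  have hadm : perturb S i φ ∈ m.admissible (x + y) := by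
    refine mem_admissible_iff.2 ⟨fun t ht => ?_, fun t ht => ?_, fun t ht => ?_⟩
    · exact intervalIntegrable_perturb (intervalIntegrable_of_admissible hS le_rfl ht)
        (hφi t ht) i
    · exact perturb_mem_orthant (hS.2.1 t ht) (hSφ t ht)
    · rcases le_or_gt t δ with htδ | htδ
      · exact openOrthant_subset_orthant (hcapin t ⟨ht, htδ⟩)
      · rw [hcapout t htδ]
        exact hS.2.2 t ht
  have hyin : x + y ∈ openOrthant n := by
    have := hcapin 0 ⟨le_rfl, hδ.le⟩
    rwa [capital_zero] at this
  have hdom : ∀ᵐ t ∂volume.restrict (Set.Ici (0 : ℝ)), S t i + φ t ∈ utilityDom m.γ := by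
    filter_upwards [hf.1, ae_restrict_mem measurableSet_Ici] with t h1 h2
    simp only [hφ]
    split_ifs
    · exact mem_utilityDom_of_pos (targetStep_mem hε0 hε1 (ha t) (hS.2.1 t h2 i))
    · simpa using h1 i
  have hle : ∀ᵐ t ∂volume.restrict (Set.Ici (0 : ℝ)), w t * φ t ≤ m.utilityChange S i φ t := by
    filter_upwards [hf.1] with t h1
    simp only [hφ, utilityChange]
    split_ifs
    · exact le_targetStep_objective h.γ_pos hε0 hε1 (ha t) (h1 i)
    · simp
  have hgδ : IntegrableOn (fun t => w t * φ t) (Set.Icc 0 δ) := by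
    rw [← intervalIntegrable_iff_integrableOn_Icc_of_le hδ.le]
    exact (hφi δ hδ.le).continuousOn_mul hwc.continuousOn
  have hzero : ∀ t ∈ Set.Ici (0 : ℝ) \ Set.Icc 0 δ, w t * φ t = 0 := by
    intro t ht
    rw [hφout t (not_le.1 fun hc => ht.2 ⟨ht.1, hc⟩), mul_zero]
  have hg : IntegrableOn (fun t => w t * φ t) (Set.Ici 0) :=
    hgδ.of_forall_sdiff_eq_zero measurableSet_Ici hzero
  have hgint : ∫ t in Set.Ici (0 : ℝ), w t * φ t = inner ℝ q y := by
    rw [setIntegral_eq_of_subset_of_forall_sdiff_eq_zero measurableSet_Ici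
      Set.Icc_subset_Ici_self hzero, integral_Icc_eq_integral_Ioc,
      ← intervalIntegral.integral_of_le hδ.le, hy, ← innerSL_apply_apply ℝ,
      ← (innerSL ℝ q).intervalIntegral_comp_comm (hφvi δ hδ.le)]
    refine intervalIntegral.integral_congr fun s _ => ?_
    simp only [innerSL_apply_apply, inner_smul_right]
    rw [mul_comm]
  obtain ⟨hint, hgain⟩ := h.integral_utilityChange_le hf hadm hdom hg hle
  have hq1 := hq (x + y) hyin
  rw [add_sub_cancel_left] at hq1
  -- The integrand is nonnegative by the choice of `φ`, while the supergradient inequality at `x +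
  -- y` makes its integral nonpositive.
  have hdiff : ∫ t in Set.Ici (0 : ℝ), (m.utilityChange S i φ t - w t * φ t) = 0 := by
    refine le_antisymm ?_ (integral_nonneg_of_ae (hle.mono fun t ht => sub_nonneg.2 ht))
    rw [integral_sub hint hg, hgint]
    linarith
  have hae := (integral_eq_zero_iff_of_nonneg_ae (hle.mono fun t ht => sub_nonneg.2 ht)
    (hint.sub hg)).1 hdiff
  filter_upwards [ae_restrict_of_ae_restrict_of_subset Set.Icc_subset_Ici_self hae,
    ae_restrict_of_ae_restrict_of_subset Set.Icc_subset_Ici_self hf.1,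
    ae_restrict_mem measurableSet_Icc] with s h1 h2 h3
  simp only [Pi.zero_apply, utilityChange, hφ, h3.2, if_true] at h1
  have htarget : S s i = target m.γ (m.p i * Real.exp (-m.ρ * s)) (w s) (S s i) := by
    by_contra hne
    have := lt_targetStep_objective h.γ_pos hε0 hε1 (ha s) (h2 i) hne
    linarith
  -- For `w s ≤ 0` the target is `S s i + 1`, so it cannot equal `S s i`.
  have hw0 : 0 < w s := by
    by_contra hc
    simp only [target, not_lt.1 hc, if_true] at htarget
    linarith
  refine ⟨hw0, ?_⟩
  simpa only [target, not_le.2 hw0, if_false] using htarget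

end Model

/-! ### The feedback formula -/

namespace Model

variable {n : ℕ} {m : Model n} {lam : ℝ} {b : EuclideanSpace ℝ (Fin n)}

/-- The costate with terminal value `q` at time `0`, paired with the consumption goods. -/
def costate (m : Model n) (q : EuclideanSpace ℝ (Fin n)) (i : Fin n) (s : ℝ) : ℝ :=
  Real.exp (m.ρ * s) * inner ℝ q (m.unitEffect i s)

lemma continuous_costate (q : EuclideanSpace ℝ (Fin n)) (i : Fin n) :
    Continuous (m.costate q i) := by
  have h := continuous_const (y := q).inner (𝕜 := ℝ) (continuous_unitEffect (m := m) i)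
  unfold costate
  fun_prop

lemma costate_zero (q : EuclideanSpace ℝ (Fin n)) (i : Fin n) :
    m.costate q i 0 = ContinuousLinearMap.adjoint m.N q i := by
  unfold costate unitEffect
  rw [backFlow_zero, adjoint_apply_coord]
  simp

lemma feedback_apply (q : EuclideanSpace ℝ (Fin n)) (i : Fin n) :
    m.feedback q i = (m.p i / ContinuousLinearMap.adjoint m.N q i) ^ (1 / m.γ) := rfl

lemma Standing.feedback_mem_openOrthant (h : m.Standing lam b) {q : EuclideanSpace ℝ (Fin n)}
    (hq : ContinuousLinearMap.adjoint m.N q ∈ openOrthant n) : m.feedback q ∈ openOrthant n :=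
  fun i => Real.rpow_pos_of_pos (div_pos (h.p_pos i) (hq i)) _

/-- The objective splits into concave functions of single coordinates, and `m.feedback q` solves
each first-order condition. Off the utility domain the objective is `⊥`. -/
lemma Standing.isMaxOn_feedback (h : m.Standing lam b) {q : EuclideanSpace ℝ (Fin n)}
    (hq : ContinuousLinearMap.adjoint m.N q ∈ openOrthant n) :
    IsMaxOn (m.hamiltonianObjective q) (orthant n) (m.feedback q) := by
  intro c hc
  have hpos := h.feedback_mem_openOrthant hq
  have hfdom : m.feedback q ∈ m.utilityDomain := fun i => mem_utilityDom_of_pos (hpos i)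
  change m.hamiltonianObjective q c ≤ m.hamiltonianObjective q (m.feedback q)
  unfold hamiltonianObjective
  by_cases hd : c ∈ m.utilityDomain
  · rw [m.totalUtility_of_mem hd, m.totalUtility_of_mem hfdom, ← EReal.coe_add, ← EReal.coe_add,
      EReal.coe_le_coe_iff]
    have hN : ∀ c : EuclideanSpace ℝ (Fin n),
        inner ℝ (m.N c) q = ∑ i, ContinuousLinearMap.adjoint m.N q i * c i := by
      intro c
      rw [← ContinuousLinearMap.adjoint_inner_right, PiLp.inner_apply]
      rfl
    rw [hN, hN, neg_add_eq_sub, neg_add_eq_sub]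
    unfold realTotalUtility
    rw [← Finset.sum_sub_distrib, ← Finset.sum_sub_distrib]
    refine Finset.sum_le_sum fun i _ => ?_
    have h1 := realUtility_le_tangent h.γ_pos (hd i) (hpos i)
    have h2 : (m.feedback q i) ^ (-m.γ) = ContinuousLinearMap.adjoint m.N q i / m.p i := by
      rw [feedback_apply, rpow_inv_rpow_neg h.γ_pos (h.p_pos i) (hq i)]
    rw [h2] at h1
    have h3 := mul_le_mul_of_nonneg_left h1 (h.p_pos i).le
    have h4 := (h.p_pos i).ne'
    have h5 : m.p i * (realUtility m.γ (m.feedback q i)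
        + ContinuousLinearMap.adjoint m.N q i / m.p i * (c i - m.feedback q i))
        = m.p i * realUtility m.γ (m.feedback q i)
          + ContinuousLinearMap.adjoint m.N q i * (c i - m.feedback q i) := by
      field_simp
    linarith
  · rw [m.totalUtility_of_notMem h.p_pos hc hd, EReal.add_bot]
    exact bot_le

lemma gradient_mem_superdifferential {f : EuclideanSpace ℝ (Fin n) → ℝ}
    {x : EuclideanSpace ℝ (Fin n)} (hf : DifferentiableAt ℝ f x)
    (E : Set (EuclideanSpace ℝ (Fin n))) : gradient f x ∈ superdifferential E f x := by
  intro ε hε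
  have h1 := hf.hasGradientAt.hasFDerivAt
  rw [hasFDerivAt_iff_isLittleO, Asymptotics.isLittleO_iff] at h1
  filter_upwards [(h1 hε).filter_mono nhdsWithin_le_nhds] with y hy
  exact (le_abs_self _).trans hy

/-! ### Optimal paths at interior times -/

/-- A state in the open orthant together with an optimal control of finite gain. -/
structure OptimalPath (m : Model n) (k : EuclideanSpace ℝ (Fin n))
    (C : ℝ → EuclideanSpace ℝ (Fin n)) : Prop where
  admissible : C ∈ m.admissible k
  finiteGain : m.FiniteGain C
  optimal : m.realGain C = m.valueReal k

variable {k : EuclideanSpace ℝ (Fin n)} {C : ℝ → EuclideanSpace ℝ (Fin n)}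

lemma Standing.optimalPath_of_isOptimal (h : m.Standing lam b) (hV : m.value k ≠ ⊥)
    (hC : m.IsOptimal k C) : m.OptimalPath k C := by
  have hf := h.finiteGain_of_gain_ne_bot hC.1 (by rw [hC.2]; exact hV)
  refine ⟨hC.1, hf, ?_⟩
  have := hC.2
  rw [gain_of_finiteGain hf] at this
  rw [valueReal, ← this, EReal.toReal_coe]

lemma Standing.optimalPath_shift (h : m.Standing lam b) (hC : m.OptimalPath k C) {t : ℝ}
    (ht : 0 ≤ t) : m.OptimalPath (m.capital k C t) (fun s => C (t + s)) :=
  ⟨shift_mem_admissible hC.admissible ht, finiteGain_shift hC.finiteGain ht,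
    h.realGain_shift_eq hC.admissible hC.finiteGain hC.optimal ht⟩

lemma Standing.concaveOn_of_optimalPath (h : m.Standing lam b) (hC : m.OptimalPath k C) :
    ConcaveOn ℝ (openOrthant n) m.valueReal :=
  h.concaveOn_valueReal fun _ hy => h.value_ne_bot hC.admissible hC.finiteGain hy

/-- A single supergradient at `t₀` determines consumption on the whole interval: this is
`optimal_eq_of_supergradient` for the tail starting at `t₀`, with the discount factor absorbed into
the costate. -/
lemma Standing.ae_costate (h : m.Standing lam b) (hC : m.OptimalPath k C) {t₀ t₁ : ℝ}
    (h₀ : 0 ≤ t₀) (hlt : t₀ < t₁) (hin : Set.Icc t₀ t₁ ⊆ m.interiorTimes k C)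
    {q : EuclideanSpace ℝ (Fin n)}
    (hq : q ∈ supergradients (openOrthant n) m.valueReal (m.capital k C t₀)) (i : Fin n) :
    ∀ᵐ s ∂volume.restrict (Set.Icc t₀ t₁), 0 < m.costate q i (s - t₀) ∧
      C s i = (m.p i / m.costate q i (s - t₀)) ^ (1 / m.γ) := by
  have hsh := h.optimalPath_shift hC h₀
  have hcap : ∀ t ∈ Set.Icc 0 (t₁ - t₀),
      m.capital (m.capital k C t₀) (fun s => C (t₀ + s)) t ∈ openOrthant n := by
    intro t ht
    rw [← capital_shift (intervalIntegrable_of_admissible hC.admissible le_rfl h₀)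
      (intervalIntegrable_of_admissible hC.admissible h₀ (add_nonneg h₀ ht.1))]
    exact (hin ⟨by linarith [ht.1], by linarith [ht.2]⟩).2
  have h1 := h.optimal_eq_of_supergradient hsh.admissible hsh.finiteGain hsh.optimal hq
    (sub_pos.2 hlt) hcap i
  rw [ae_restrict_iff' measurableSet_Icc] at h1 ⊢
  filter_upwards [(measurePreserving_sub_right (volume : Measure ℝ)
    t₀).quasiMeasurePreserving.ae h1] with s hs hst
  obtain ⟨h2, h3⟩ := hs ⟨by linarith [hst.1], by linarith [hst.2]⟩
  rw [add_sub_cancel] at h3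
  refine ⟨mul_pos (Real.exp_pos _) h2, ?_⟩
  rw [h3]
  congr 1
  unfold costate
  rw [neg_mul, Real.exp_neg]
  have := Real.exp_pos (m.ρ * (s - t₀))
  field_simp

/-- The costates starting from supergradients at different times agree. -/
lemma Standing.costate_eq_adjoint (h : m.Standing lam b) (hC : m.OptimalPath k C)
    {t₀ t₁ t : ℝ} (h₀ : 0 ≤ t₀) (ht₀ : t₀ ≤ t) (ht₁ : t < t₁)
    (hin : Set.Icc t₀ t₁ ⊆ m.interiorTimes k C) {q q' : EuclideanSpace ℝ (Fin n)}
    (hq : q ∈ supergradients (openOrthant n) m.valueReal (m.capital k C t₀))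
    (hq' : q' ∈ supergradients (openOrthant n) m.valueReal (m.capital k C t)) (i : Fin n) :
    m.costate q i (t - t₀) = ContinuousLinearMap.adjoint m.N q' i := by
  have hsub : Set.Icc t t₁ ⊆ Set.Icc t₀ t₁ := Set.Icc_subset_Icc_left ht₀
  have h1 := h.ae_costate hC h₀ (ht₀.trans_lt ht₁) hin hq i
  have h2 := h.ae_costate hC (h₀.trans ht₀) ht₁ (hsub.trans hin) hq' i
  have hae : (fun s => m.costate q i (s - t₀))
      =ᵐ[volume.restrict (Set.Icc t t₁)] fun s => m.costate q' i (s - t) := by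
    filter_upwards [ae_restrict_of_ae_restrict_of_subset hsub h1, h2] with s h3 h4
    -- The power `-γ` undoes the exponent `1/γ`, so equal consumption means equal costates.
    have h5 := congrArg (fun x : ℝ => x ^ (-m.γ)) (h3.2.symm.trans h4.2)
    rw [rpow_inv_rpow_neg h.γ_pos (h.p_pos i) h3.1,
      rpow_inv_rpow_neg h.γ_pos (h.p_pos i) h4.1] at h5
    have := (h.p_pos i).ne'
    field_simp at h5
    exact h5
  -- Continuous functions that agree almost everywhere on a nondegenerate interval agree at its left
  -- endpoint `t`.
  have := Measure.eqOn_Icc_of_ae_eq volume ht₁.ne hae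
    ((continuous_costate q i).comp (continuous_sub_right t₀)).continuousOn
    ((continuous_costate q' i).comp (continuous_sub_right t)).continuousOn
    (Set.left_mem_Icc.2 ht₁.le)
  simp only [sub_self, costate_zero] at this
  exact this

/-- Interior times have a relative neighborhood consisting of interior times. -/
lemma exists_Icc_subset_interiorTimes (hC : C ∈ m.admissible k) {t : ℝ}
    (ht : t ∈ m.interiorTimes k C) : ∃ t₀ t₁ : ℝ, 0 ≤ t₀ ∧ t₀ ≤ t ∧ t < t₁ ∧
      Set.Icc t₀ t₁ ⊆ m.interiorTimes k C ∧ Set.Ico t₀ t₁ ∈ 𝓝[m.interiorTimes k C] t := by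
  have hcont := continuousOn_capital (m := m) (k := k) (mem_admissible_iff.1 hC).1 t ht.1
  have h1 := hcont.eventually_mem (isOpen_openOrthant.mem_nhds ht.2)
  obtain ⟨ε, hε, hball⟩ := Metric.mem_nhdsWithin_iff.1 h1
  -- The maximum covers `t = 0`, where only a right neighborhood is available; `t < t₁` holds in all
  -- cases.
  refine ⟨max 0 (t - ε / 2), t + ε / 2, le_max_left _ _, max_le ht.1 (by linarith),
    by linarith, fun s hs => ?_, ?_⟩
  · have hs0 : 0 ≤ s := (le_max_left _ _).trans hs.1
    refine ⟨hs0, hball ⟨?_, hs0⟩⟩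
    have := (le_max_right 0 (t - ε / 2)).trans hs.1
    rw [Metric.mem_ball, Real.dist_eq, abs_lt]
    constructor <;> linarith [hs.2]
  · rw [mem_nhdsWithin]
    refine ⟨Set.Ioo (t - ε / 2) (t + ε / 2), isOpen_Ioo, ⟨by linarith, by linarith⟩,
      fun s hs => ⟨max_le hs.2.1 hs.1.1.le, hs.1.2⟩⟩

open Classical in
/-- The continuous version of an optimal control at interior times. -/
def feedbackControl (m : Model n) (k : EuclideanSpace ℝ (Fin n))
    (C : ℝ → EuclideanSpace ℝ (Fin n)) (t : ℝ) : EuclideanSpace ℝ (Fin n) :=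
  if h : (supergradients (openOrthant n) m.valueReal (m.capital k C t)).Nonempty
  -- At interior times of an optimal path a supergradient exists, so the default `0` is not used
  -- there.
  then m.feedback h.some else 0

/-- The supergradient chosen at `t` does not matter: the feedback depends on it only through its
image under the adjoint of `m.N`, which is the costate transported from `t₀`. -/
lemma Standing.feedbackControl_eq (h : m.Standing lam b) (hC : m.OptimalPath k C)
    {t₀ t₁ t : ℝ} (h₀ : 0 ≤ t₀) (ht₀ : t₀ ≤ t) (ht₁ : t < t₁)
    (hin : Set.Icc t₀ t₁ ⊆ m.interiorTimes k C) {q : EuclideanSpace ℝ (Fin n)}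
    (hq : q ∈ supergradients (openOrthant n) m.valueReal (m.capital k C t₀)) (i : Fin n) :
    m.feedbackControl k C t i = (m.p i / m.costate q i (t - t₀)) ^ (1 / m.γ) := by
  have hne := ConcaveOn.supergradients_nonempty isOpen_openOrthant
    (h.concaveOn_of_optimalPath hC) (hin ⟨ht₀, ht₁.le⟩).2
  rw [feedbackControl, dif_pos hne, feedback_apply,
    h.costate_eq_adjoint hC h₀ ht₀ ht₁ hin hq hne.some_mem]

lemma Standing.feedbackControl_eq_feedback (h : m.Standing lam b) (hC : m.OptimalPath k C)
    {t : ℝ} (ht : t ∈ m.interiorTimes k C) {q : EuclideanSpace ℝ (Fin n)}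
    (hq : q ∈ supergradients (openOrthant n) m.valueReal (m.capital k C t)) :
    m.feedbackControl k C t = m.feedback q := by
  obtain ⟨t₀, t₁, h₀, ht₀, ht₁, hin, -⟩ := exists_Icc_subset_interiorTimes hC.admissible ht
  ext i
  rw [h.feedbackControl_eq hC ht.1 le_rfl ht₁ ((Set.Icc_subset_Icc_left ht₀).trans hin) hq i,
    sub_self, costate_zero, feedback_apply]

lemma Standing.adjoint_mem_of_interiorTimes (h : m.Standing lam b) (hC : m.OptimalPath k C)
    {t : ℝ} (ht : t ∈ m.interiorTimes k C) {q : EuclideanSpace ℝ (Fin n)}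
    (hq : q ∈ supergradients (openOrthant n) m.valueReal (m.capital k C t)) :
    ContinuousLinearMap.adjoint m.N q ∈ openOrthant n := by
  have hsh := h.optimalPath_shift hC ht.1
  exact h.adjoint_mem_openOrthant ht.2 hsh.admissible hsh.finiteGain hsh.optimal hq

/-- Near `t` the control is an explicit function of one continuous costate, started at a common
earlier time `t₀`. Division is safe since that costate at `t` is a coordinate of `Nᵀ q'`, positive
for every supergradient `q'` at `t`. -/
lemma Standing.continuousOn_feedbackControl (h : m.Standing lam b) (hC : m.OptimalPath k C) :
    ContinuousOn (m.feedbackControl k C) (m.interiorTimes k C) := by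
  intro t ht
  obtain ⟨t₀, t₁, h₀, ht₀, ht₁, hin, hnhds⟩ := exists_Icc_subset_interiorTimes hC.admissible ht
  have hconc := h.concaveOn_of_optimalPath hC
  obtain ⟨q, hq⟩ := ConcaveOn.supergradients_nonempty isOpen_openOrthant hconc
    (hin ⟨le_rfl, ht₀.trans ht₁.le⟩).2
  obtain ⟨q', hq'⟩ := ConcaveOn.supergradients_nonempty isOpen_openOrthant hconc ht.2
  have hcont : ContinuousAt (fun s => (WithLp.toLp 2 fun i =>
      (m.p i / m.costate q i (s - t₀)) ^ (1 / m.γ) : EuclideanSpace ℝ (Fin n))) t := by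
    refine (PiLp.continuous_toLp 2 _).continuousAt.comp (continuousAt_pi.2 fun i => ?_)
    have hpos : 0 < m.costate q i (t - t₀) := by
      rw [h.costate_eq_adjoint hC h₀ ht₀ ht₁ hin hq hq']
      exact h.adjoint_mem_of_interiorTimes hC ht hq' i
    refine ContinuousAt.rpow_const (ContinuousAt.div continuousAt_const
      ((continuous_costate q i).comp (continuous_sub_right t₀)).continuousAt hpos.ne') ?_
    exact Or.inl (div_pos (h.p_pos i) hpos).ne'
  refine hcont.continuousWithinAt.congr_of_eventuallyEq ?_ ?_
  · filter_upwards [hnhds] with s hs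
    ext i
    exact h.feedbackControl_eq hC h₀ hs.1 hs.2 hin hq i
  · ext i
    exact h.feedbackControl_eq hC h₀ ht₀ ht₁ hin hq i

/-- The exceptional set is null near each of its points, hence null. -/
lemma Standing.ae_eq_feedbackControl (h : m.Standing lam b) (hC : m.OptimalPath k C) :
    ∀ᵐ t : ℝ, t ∈ m.interiorTimes k C → C t = m.feedbackControl k C t := by
  have hconc := h.concaveOn_of_optimalPath hC
  have hnull : volume {t | t ∈ m.interiorTimes k C ∧ C t ≠ m.feedbackControl k C t} = 0 := by
    refine measure_null_of_locally_null _ fun t ht => ?_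
    obtain ⟨t₀, t₁, h₀, ht₀, ht₁, hin, hnhds⟩ :=
      exists_Icc_subset_interiorTimes hC.admissible ht.1
    obtain ⟨q, hq⟩ := ConcaveOn.supergradients_nonempty isOpen_openOrthant hconc
      (hin ⟨le_rfl, ht₀.trans ht₁.le⟩).2
    refine ⟨Set.Ico t₀ t₁ ∩ {t | t ∈ m.interiorTimes k C ∧ C t ≠ m.feedbackControl k C t},
      inter_mem (nhdsWithin_mono t (fun s hs => hs.1) hnhds) self_mem_nhdsWithin, ?_⟩
    have h1 := ae_all_iff.2 fun i => h.ae_costate hC h₀ (ht₀.trans_lt ht₁) hin hq i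
    rw [ae_restrict_iff' measurableSet_Icc] at h1
    refine measure_mono_null (fun s hs => ?_) h1
    intro hcon
    apply hs.2.2
    ext i
    rw [(hcon ⟨hs.1.1, hs.1.2.le⟩ i).2, h.feedbackControl_eq hC h₀ hs.1.1 hs.1.2 hin hq i]
  filter_upwards [compl_mem_ae_iff.2 hnull] with t ht hti
  by_contra hne
  exact ht ⟨hti, hne⟩

/-- In finite dimension an injective operator is surjective, and the adjoint of a surjective
operator is injective. -/
lemma adjoint_injective_of_injective
    {P : EuclideanSpace ℝ (Fin n) →L[ℝ] EuclideanSpace ℝ (Fin n)}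
    (hP : Function.Injective P) : Function.Injective (ContinuousLinearMap.adjoint P) := by
  have hsurj : Function.Surjective P :=
    LinearMap.injective_iff_surjective (f := (P : EuclideanSpace ℝ (Fin n) →ₗ[ℝ] _)).1 hP
  intro q q' hqq
  refine ext_inner_right ℝ fun v => ?_
  obtain ⟨u, rfl⟩ := hsurj v
  rw [← ContinuousLinearMap.adjoint_inner_left, hqq, ContinuousLinearMap.adjoint_inner_left]

end Model

end GrowthNetwork

end

/-! ### The main theorem -/

theorem mainTheorem3 {n : ℕ} (hn : 2 ≤ n) (m : GrowthNetwork.Model n)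
    (ha : ∀ i, 0 < m.a i) (hp : ∀ i, 0 < m.p i) (hρ : 0 < m.ρ) (hγ : 0 < m.γ)
    (hL : ∀ t : ℝ, 0 ≤ t → ∀ x ∈ GrowthNetwork.orthant n,
      NormedSpace.exp (t • m.L) x ∈ GrowthNetwork.orthant n)
    (hN : ∀ x ∈ GrowthNetwork.orthant n, m.N x ∈ GrowthNetwork.orthant n)
    (hN0 : ∀ i, m.N (EuclideanSpace.single i 1) ≠ 0)
    (lam : ℝ) (hlam : 0 < lam)
    (b : EuclideanSpace ℝ (Fin n)) (hb : b ∈ GrowthNetwork.openOrthant n)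
    (hblam : ContinuousLinearMap.adjoint m.drift b = lam • b)
    (hρlam : lam * (1 - m.γ) < m.ρ)
    (k : EuclideanSpace ℝ (Fin n)) (hk : k ∈ GrowthNetwork.orthant n)
    (hV : m.value k ≠ ⊥)
    (C : ℝ → EuclideanSpace ℝ (Fin n)) (hC : m.IsOptimal k C) :
    ∃ c : ℝ → EuclideanSpace ℝ (Fin n),
      (∀ᵐ t : ℝ, t ∈ m.interiorTimes k C → C t = c t) ∧
      ContinuousOn c (m.interiorTimes k C) ∧
      ∀ t ∈ m.interiorTimes k C,
        c t ∈ GrowthNetwork.openOrthant n ∧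
        (∀ᶠ x in 𝓝 (m.capital k C t), m.value x ≠ ⊥ ∧ m.value x ≠ ⊤) ∧
        (GrowthNetwork.superdifferential (GrowthNetwork.orthant n) m.valueReal
          (m.capital k C t)).Nonempty ∧
        (∀ q ∈ GrowthNetwork.superdifferential (GrowthNetwork.orthant n) m.valueReal
            (m.capital k C t),
          ContinuousLinearMap.adjoint m.N q ∈ GrowthNetwork.openOrthant n ∧
          IsMaxOn (m.hamiltonianObjective q) (GrowthNetwork.orthant n) (m.feedback q) ∧
          c t = m.feedback q) ∧
        (DifferentiableAt ℝ m.valueReal (m.capital k C t) →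
          c t = m.feedback (gradient m.valueReal (m.capital k C t))) ∧
        (Function.Injective m.N → DifferentiableAt ℝ m.valueReal (m.capital k C t)) := by
  have h : m.Standing lam b :=
    ⟨hp, hγ, hL, hN, hN0, hρ, hb, hblam, hρlam⟩
  have hpath := h.optimalPath_of_isOptimal hV hC
  have hconc := h.concaveOn_of_optimalPath hpath
  refine ⟨m.feedbackControl k C, h.ae_eq_feedbackControl hpath,
    h.continuousOn_feedbackControl hpath, fun t ht => ?_⟩
  -- By concavity, the local superdifferential relative to the closed orthant consists of global
  -- supergradients on the open orthant.
  have hsuper : ∀ q ∈ GrowthNetwork.superdifferential (GrowthNetwork.orthant n) m.valueReal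
      (m.capital k C t), q ∈ GrowthNetwork.supergradients (GrowthNetwork.openOrthant n)
        m.valueReal (m.capital k C t) := fun q hq =>
    GrowthNetwork.ConcaveOn.mem_supergradients hconc
      GrowthNetwork.openOrthant_subset_orthant ht.2 hq
  obtain ⟨q₀, hq₀⟩ := GrowthNetwork.ConcaveOn.supergradients_nonempty
    GrowthNetwork.isOpen_openOrthant hconc ht.2
  refine ⟨?_, ?_, ⟨q₀, fun ε hε => ?_⟩, fun q hq => ?_, fun hdiff => ?_, fun hinj => ?_⟩
  · rw [h.feedbackControl_eq_feedback hpath ht hq₀]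
    exact h.feedback_mem_openOrthant (h.adjoint_mem_of_interiorTimes hpath ht hq₀)
  · filter_upwards [GrowthNetwork.isOpen_openOrthant.mem_nhds ht.2] with x hx
    exact ⟨h.value_ne_bot hpath.admissible hpath.finiteGain hx, h.value_ne_top x⟩
  · exact (GrowthNetwork.eventually_of_mem_supergradients GrowthNetwork.isOpen_openOrthant ht.2
      hq₀ hε).filter_mono nhdsWithin_le_nhds
  · have hq' := hsuper q hq
    have hadj := h.adjoint_mem_of_interiorTimes hpath ht hq'
    exact ⟨hadj, h.isMaxOn_feedback hadj, h.feedbackControl_eq_feedback hpath ht hq'⟩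
  · exact h.feedbackControl_eq_feedback hpath ht
      (hsuper _ (GrowthNetwork.Model.gradient_mem_superdifferential hdiff _))
  · refine GrowthNetwork.ConcaveOn.differentiableAt_of_subsingleton
      GrowthNetwork.isOpen_openOrthant hconc ht.2 fun q hq q' hq' => ?_
    obtain ⟨t₀, t₁, h₀, ht₀, ht₁, hin, -⟩ :=
      GrowthNetwork.Model.exists_Icc_subset_interiorTimes hpath.admissible ht
    -- Any two supergradients at an interior time have the same image under the adjoint: compare
    -- their costates at elapsed time zero.
    refine GrowthNetwork.Model.adjoint_injective_of_injective hinj ?_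
    ext i
    have h1 := h.costate_eq_adjoint hpath ht.1 le_rfl ht₁
      ((Set.Icc_subset_Icc_left ht₀).trans hin) hq hq' i
    rwa [sub_self, GrowthNetwork.Model.costate_zero] at h1
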